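/- **Setting.** Let $T>0$, $\Omega=(0,1)$, $Q=\Omega\times(0,T)$, and let $\omega\subset\Omega$ be a non-empty open interval. Consider the degenerate system $$ \begin{cases} u_t-b(t)\,(a(x)u_x)_x+d_1(x,t)\sqrt a\,u_x+b_{11}(x,t)u+b_{12}(x,t)v=h1_\omega+H_1 & \text{in } Q,\\ v_t-b(t)\,(a(x)v_x)_x+d_2(x,t)\sqrt a\,v_x+b_{21}(x,t)u+b_{22}(x,t)v=H_2 & \text{in } Q,\\ u(0,t)=u(1,t)=v(0,t)=v(1,t)=0 & \text{on } (0,T),\\ u(\cdot,0)=u_0,\quad v(\cdot,0)=v_0 & \text{in } \Omega. \end{cases}\tag{1} $$ Here $a\in C([0,1])\cap C^1((0,1])$, $a(0)=0$, $a>0$ and $a'\ge 0$ on $(0,1]$, and $xa'(x)\le Ka(x)$ on $(0,1]$ for some $K\in[0,1)$; $b\in W^{1,\infty}(0,T)$ and $b\ge b_0$ for a constant $b_0>0$; the functions $d_i,b_{ij}$ are measurable and bounded on $Q$. Let $M$ be a common upper bound of $b$, $|d_i|$ and $|b_{ij}|$ (all bounds almost everywhere). Let $H^1_a(0,1)$ be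 the space of the functions $f\in L^2(0,1)$ that are absolutely continuous, with $f(0)=f(1)=0$ and $\sqrt a f_x\in L^2(0,1)$, and let $H^2_a(0,1)=\{f\in H^1_a(0,1): af_x\in H^1(0,1)\}$, with the norms $\|f\|_{H^1_a}^2=\|f\|_{L^2}^2+\|\sqrt a f_x\|_{L^2}^2$ and $\|f\|_{H^2_a}^2=\|f\|_{H^1_a}^2+\|(af_x)_x\|_{L^2}^2$. Put $$E=L^2(0,T;H^2_a(0,1))\cap H^1(0,T;L^2(0,1)),\qquad \|u\|_E=\|u\|_{L^2(0,T;H^2_a)}+\|u\|_{H^1(0,T;L^2)}.$$ A solution of (1) is a pair $(u,v)\in E\times E$ that satisfies the two equations almost everywhere in $Q$ and whose continuous representatives $[0,T]\to L^2(0,1)$ take the values $u_0,v_0$ at $t=0$ (the boundary conditions are contained in $u(t),v(t)\in H^2_a(0,1)$ for almost every $t$). **Proposition 2.1 (well-posedness).** For all $u_0,v_0\in H^1_a(0,1)$, $h\in L^2(0,T;L^2(\omega))$ and $H_1,H_2\in L^2(0,T;L^2(0,1))$, the system (1) has a unique solution $(u,v)$, and $$ \|u\|_E+\|v\|_E\le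 C\Big(\|u_0\|_{H^1_a}+\|v_0\|_{H^1_a}+\|h\|_{L^2(0,T;L^2(\omega))}+\sum_{i=1}^2\|H_i\|_{L^2(0,T;L^2(0,1))}\Big), $$ where the constant $C>0$ depends only on $T$, $b_0$ and $M$ (in particular not on $u_0,v_0,h,H_1,H_2$ nor on $\omega$). -/

import Mathlib

open MeasureTheory Set
open scoped ENNReal ContDiff

noncomputable section

namespace DegenerateSystem

/-- Lebesgue measure on the spatial domain `Ω = (0,1)`. -/
abbrev μΩ : Measure ℝ := volume.restrict (Ioo (0 : ℝ) 1)

/-- Lebesgue measure on the time interval `(0,T)`. -/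
abbrev μT (T : ℝ) : Measure ℝ := volume.restrict (Ioo (0 : ℝ) T)

/-- Lebesgue measure on the cylinder `Q = (0,1) × (0,T)`; points are written `(x,t)`. -/
abbrev μQ (T : ℝ) : Measure (ℝ × ℝ) := volume.restrict (Ioo (0 : ℝ) 1 ×ˢ Ioo (0 : ℝ) T)

/-- The Hilbert space `L²(0,1)`. -/
abbrev L2Ω : Type := Lp ℝ 2 μΩ

/-! ### The coefficients -/

/-- The (weakly degenerate) diffusion coefficient: `a ∈ C([0,1]) ∩ C¹((0,1])`, `a(0) = 0`, `a > 0`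
and `a' ≥ 0` on `(0,1]`, and `x a'(x) ≤ K a(x)` for some `K ∈ [0,1)`. -/
structure WeaklyDegenerate (a : ℝ → ℝ) : Prop where
  continuousOn : ContinuousOn a (Icc 0 1)
  contDiffOn : ContDiffOn ℝ 1 a (Ioc 0 1)
  zero : a 0 = 0
  pos : ∀ x ∈ Ioc (0 : ℝ) 1, 0 < a x
  deriv_nonneg : ∀ x ∈ Ioc (0 : ℝ) 1, 0 ≤ derivWithin a (Ioc 0 1) x
  exists_K : ∃ K : ℝ, 0 ≤ K ∧ K < 1 ∧
    ∀ x ∈ Ioc (0 : ℝ) 1, x * derivWithin a (Ioc 0 1) x ≤ K * a x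

/-- `b ∈ W^{1,∞}(0,T)`: `b` is essentially bounded and has an essentially bounded weak
derivative. -/
def MemW1Infty (T : ℝ) (b : ℝ → ℝ) : Prop :=
  MemLp b ∞ (μT T) ∧ ∃ b' : ℝ → ℝ, MemLp b' ∞ (μT T) ∧
    ∀ φ : ℝ → ℝ, ContDiff ℝ ∞ φ → HasCompactSupport φ → tsupport φ ⊆ Ioo 0 T →
      ∫ t, b t * deriv φ t ∂(μT T) = - ∫ t, b' t * φ t ∂(μT T)

/-- A measurable function of `(x,t)` that is bounded by `M` almost everywhere on `Q`. -/
def BoundedOnQ (T M : ℝ) (c : ℝ → ℝ → ℝ) : Prop :=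
  AEStronglyMeasurable (fun z : ℝ × ℝ => c z.1 z.2) (μQ T) ∧ ∀ᵐ z ∂(μQ T), |c z.1 z.2| ≤ M

/-- The coefficients of the system; `d₁, d₂` and the `bᵢⱼ` are functions of `x` and `t`. -/
structure Coefficients where
  a : ℝ → ℝ
  b : ℝ → ℝ
  d₁ : ℝ → ℝ → ℝ
  d₂ : ℝ → ℝ → ℝ
  b₁₁ : ℝ → ℝ → ℝ
  b₁₂ : ℝ → ℝ → ℝ
  b₂₁ : ℝ → ℝ → ℝ
  b₂₂ : ℝ → ℝ → ℝ

/-- The assumptions on the coefficients, with the lower bound `b₀` of `b` and a common upper bound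
`M` of `b`, `|dᵢ|` and `|bᵢⱼ|`. -/
structure Coefficients.Admissible (T b₀ M : ℝ) (c : Coefficients) : Prop where
  a_deg : WeaklyDegenerate c.a
  b_mem : MemW1Infty T c.b
  b_lower : ∀ᵐ t ∂(μT T), b₀ ≤ c.b t
  b_upper : ∀ᵐ t ∂(μT T), c.b t ≤ M
  d₁_bdd : BoundedOnQ T M c.d₁
  d₂_bdd : BoundedOnQ T M c.d₂
  b₁₁_bdd : BoundedOnQ T M c.b₁₁
  b₁₂_bdd : BoundedOnQ T M c.b₁₂
  b₂₁_bdd : BoundedOnQ T M c.b₂₁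
  b₂₂_bdd : BoundedOnQ T M c.b₂₂

/-! ### The weighted spaces `H¹ₐ(0,1)` and `H²ₐ(0,1)` -/

/-- `F` is the absolutely continuous representative, vanishing at `0` and `1`, of `f`.
If `√a f_x ∈ L²` and `1/a ∈ L¹` (as for weakly degenerate `a`) then `f_x ∈ L¹`, so that absolute
continuity on `(0,1]` and on `[0,1]` (with `f(0)` the limit at `0`) are the same. -/
def IsRep (f : L2Ω) (F : ℝ → ℝ) : Prop :=
  AbsolutelyContinuousOnInterval F 0 1 ∧ F 0 = 0 ∧ F 1 = 0 ∧ f =ᵐ[μΩ] F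

/-- `f ∈ H¹ₐ(0,1)` and `p = √a f_x`. -/
def HasSqrtADx (a : ℝ → ℝ) (f p : L2Ω) : Prop :=
  ∃ F : ℝ → ℝ, IsRep f F ∧ p =ᵐ[μΩ] fun x => √(a x) * deriv F x

/-- `f ∈ H¹ₐ(0,1)`. -/
def MemH1a (a : ℝ → ℝ) (f : L2Ω) : Prop := ∃ p, HasSqrtADx a f p

/-- `f ∈ H²ₐ(0,1)` and `q = (a f_x)_x`: `f ∈ H¹ₐ(0,1)`, and `a f_x` belongs to `H¹(0,1)`, that is,
it has an absolutely continuous representative `W` on `[0,1]` with `W' = q ∈ L²(0,1)`. -/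
def HasDivADx (a : ℝ → ℝ) (f q : L2Ω) : Prop :=
  MemH1a a f ∧ ∃ F W : ℝ → ℝ, IsRep f F ∧ AbsolutelyContinuousOnInterval W 0 1 ∧
    (W =ᵐ[μΩ] fun x => a x * deriv F x) ∧ q =ᵐ[μΩ] deriv W

/-- `f ∈ H²ₐ(0,1)`. -/
def MemH2a (a : ℝ → ℝ) (f : L2Ω) : Prop := ∃ q, HasDivADx a f q

open Classical in
/-- `√a f_x ∈ L²(0,1)` for `f ∈ H¹ₐ(0,1)` (and `0` for other `f`). -/
def sqrtADx (a : ℝ → ℝ) (f : L2Ω) : L2Ω :=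
  if hf : MemH1a a f then hf.choose else 0

open Classical in
/-- `(a f_x)_x ∈ L²(0,1)` for `f ∈ H²ₐ(0,1)` (and `0` for other `f`). -/
def divADx (a : ℝ → ℝ) (f : L2Ω) : L2Ω :=
  if hf : MemH2a a f then hf.choose else 0

/-- The norm of `H¹ₐ(0,1)`. -/
def normH1a (a : ℝ → ℝ) (f : L2Ω) : ℝ := √(‖f‖ ^ 2 + ‖sqrtADx a f‖ ^ 2)

/-- The norm of `H²ₐ(0,1)`. -/
def normH2a (a : ℝ → ℝ) (f : L2Ω) : ℝ := √(normH1a a f ^ 2 + ‖divADx a f‖ ^ 2)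

/-! ### The spaces `L²(0,T;H²ₐ)` and `H¹(0,T;L²)` -/

/-- `u ∈ L²(0,T;H²ₐ(0,1))`. Since `f ↦ (f, √a f_x, (a f_x)_x)` is an isometry of `H²ₐ(0,1)` into
`L²(0,1)³`, measurability and square integrability can be read off the three components. -/
def MemL2H2a (T : ℝ) (a : ℝ → ℝ) (u : ℝ → L2Ω) : Prop :=
  (∀ᵐ t ∂(μT T), MemH2a a (u t)) ∧ MemLp u 2 (μT T) ∧
    MemLp (fun t => sqrtADx a (u t)) 2 (μT T) ∧ MemLp (fun t => divADx a (u t)) 2 (μT T)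

/-- `u` is (the continuous representative on `[0,T]` of) an element of `H¹(0,T;L²(0,1))` with time
derivative `u'`. -/
def HasTimeDeriv (T : ℝ) (u u' : ℝ → L2Ω) : Prop :=
  MemLp u' 2 (μT T) ∧ ∀ t ∈ Icc (0 : ℝ) T, u t = u 0 + ∫ s in (0 : ℝ)..t, u' s

/-- `u ∈ H¹(0,T;L²(0,1))`. -/
def MemH1L2 (T : ℝ) (u : ℝ → L2Ω) : Prop := ∃ u', HasTimeDeriv T u u'

open Classical in
/-- The time derivative `u_t ∈ L²(0,T;L²(0,1))` of `u ∈ H¹(0,T;L²(0,1))`, determined almost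
everywhere on `(0,T)` (and `0` for other `u`). -/
def timeDeriv (T : ℝ) (u : ℝ → L2Ω) : ℝ → L2Ω :=
  if hu : MemH1L2 T u then hu.choose else 0

/-- The norm of `L²(0,T;H²ₐ(0,1))`. -/
def normL2H2a (T : ℝ) (a : ℝ → ℝ) (u : ℝ → L2Ω) : ℝ :=
  √(∫ t, normH2a a (u t) ^ 2 ∂(μT T))

/-- The norm of `H¹(0,T;L²(0,1))`. -/
def normH1L2 (T : ℝ) (u : ℝ → L2Ω) : ℝ :=
  √(∫ t, (‖u t‖ ^ 2 + ‖timeDeriv T u t‖ ^ 2) ∂(μT T))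

/-- The norm of the intersection `L²(0,T;H²ₐ(0,1)) ∩ H¹(0,T;L²(0,1))`. -/
def normE (T : ℝ) (a : ℝ → ℝ) (u : ℝ → L2Ω) : ℝ := normL2H2a T a u + normH1L2 T u

/-! ### Solutions of the system -/

/-- `(u,v)` is a solution on `[0,T]`, with control `h` acting on `ω = (α,β)`, sources `H₁, H₂` and
initial data `u₀, v₀`. The boundary conditions are part of the membership in `H²ₐ(0,1)`, and the
two equations hold almost everywhere in `Q`. -/
structure IsSolution (T : ℝ) (c : Coefficients) (α β : ℝ) (u₀ v₀ : L2Ω)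
    (h : ℝ → Lp ℝ 2 (volume.restrict (Ioo α β))) (H₁ H₂ : ℝ → L2Ω) (u v : ℝ → L2Ω) : Prop where
  u_memL2H2a : MemL2H2a T c.a u
  v_memL2H2a : MemL2H2a T c.a v
  u_memH1L2 : MemH1L2 T u
  v_memH1L2 : MemH1L2 T v
  u_init : u 0 = u₀
  v_init : v 0 = v₀
  eq_u : ∀ᵐ t ∂(μT T), ∀ᵐ x ∂μΩ,
    timeDeriv T u t x - c.b t * divADx c.a (u t) x + c.d₁ x t * sqrtADx c.a (u t) x
      + c.b₁₁ x t * u t x + c.b₁₂ x t * v t x = (Ioo α β).indicator (h t) x + H₁ t x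
  eq_v : ∀ᵐ t ∂(μT T), ∀ᵐ x ∂μΩ,
    timeDeriv T v t x - c.b t * divADx c.a (v t) x + c.d₂ x t * sqrtADx c.a (v t) x
      + c.b₂₁ x t * u t x + c.b₂₂ x t * v t x = H₂ t x

end DegenerateSystem

end

/-!
Write `A f = -(a f_x)_x` for the self-adjoint operator of the form `∫ a f_x φ_x` on `H¹ₐ(0,1)`.
Weak degeneracy enters only through `1/a ∈ L¹(0,1)` (`memLp_inv_sqrt`): it makes `f` the primitive
of `p/√a`, where `p = √a f_x` is orthogonal to `1/√a` in `L²(0,1)` (`hasSqrtADx_iff`), so that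
`H¹ₐ(0,1)` is a Hilbert space `V`, the `formSpace`. With `π : V → L²(0,1)` the inclusion,
`J = π π†` is `(1 + A)⁻¹`, and the weak solution `f = J w` of `f + A f = w` has a flux `a f_x`
that differs from `-∫₀ˣ (w - f)` by a constant; hence `f ∈ H²ₐ(0,1)` (`hasDivADx_resolvent`).

For one equation `u' + b A u = f` all estimates are made in `L²(0,T)` with the weight `e^{-2γt}`.
Testing with `w = u + A u` gives
`(γ - M) ‖u‖²_V + (b₀/2) ‖w‖² ≤ ½ ‖u(0)‖²_V + ‖f‖² / (2 b₀)` (`energy_estimate`). No time derivative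
of `b` is involved, since the multiplier acts on `u'` through a time-independent form. So
`u ↦ (u' + b A u, u(0))` is injective with closed range on the space of functions with
`u', u + A u ∈ L²`. The range is dense: if `g` is orthogonal to it, then for `u = J ∫₀ᵗ b g` the
energy inequality for the form of `1 - J` gives `⟪g, J (b g)⟫ ≤ 0`, which forces `g = 0`
(`eq_zero_of_orthogonal`). This is maximal regularity, `exists_parabolicEquiv`.

The terms `dᵢ √a u_x`, `bᵢⱼ u` are bounded by the norm of `V`, which the factor `γ - M` makes as
small as desired compared with the data. For `γ` large, depending on `b₀` and `M` only, they are a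
perturbation of relative norm at most `1/2`, and a Neumann series solves the system
(`exists_system_solution`). Returning to Lebesgue measure costs the factor `e^{γT}`, so the constant
depends on `T`, `b₀` and `M` only. Uniqueness (`IsSolution.eqOn`) is the same weighted energy
argument in `L²(0,1)` for the difference of two solutions.
-/

namespace DegenerateSystem

noncomputable section

open scoped RealInnerProductSpace
open ContinuousLinearMap (adjoint)

/-! ### The exponentially weighted time interval -/

/-- The measure `e^{-2γt} dt` on `(0,T)`. Energy estimates with respect to it gain the factor `γ`,
which absorbs lower-order terms when `γ` is large. -/
def expMeasure (γ T : ℝ) : Measure ℝ :=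
  (μT T).withDensity fun t => (Real.toNNReal (Real.exp (-(2 * γ * t))) : ℝ≥0∞)

lemma coe_toNNReal_eq_ofReal (x : ℝ) : ((Real.toNNReal x : NNReal) : ℝ≥0∞) = ENNReal.ofReal x := rfl

lemma ae_mem_Ioo (T : ℝ) : ∀ᵐ t ∂(μT T), t ∈ Ioo 0 T := ae_restrict_mem measurableSet_Ioo

lemma expMeasure_le {γ T : ℝ} (hγ : 0 ≤ γ) : expMeasure γ T ≤ (1 : ℝ≥0∞) • μT T := by
  have h : expMeasure γ T ≤ (μT T).withDensity 1 := by
    refine withDensity_mono ?_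
    filter_upwards [ae_mem_Ioo T] with t ht
    rw [coe_toNNReal_eq_ofReal, Pi.one_apply, ENNReal.ofReal_le_one]
    exact Real.exp_le_one_iff.2 (by nlinarith [ht.1])
  simpa using h

lemma le_expMeasure {γ T : ℝ} (hγ : 0 ≤ γ) :
    μT T ≤ ENNReal.ofReal (Real.exp (2 * γ * T)) • expMeasure γ T := by
  rw [expMeasure, ← withDensity_smul _ (by fun_prop)]
  conv_lhs => rw [← withDensity_one (μ := μT T)]
  refine withDensity_mono ?_
  filter_upwards [ae_mem_Ioo T] with t ht
  simp only [Pi.one_apply, Pi.smul_apply, smul_eq_mul]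
  rw [coe_toNNReal_eq_ofReal, ← ENNReal.ofReal_mul (Real.exp_pos _).le, ← Real.exp_add,
    ENNReal.one_le_ofReal]
  exact Real.one_le_exp (by nlinarith [ht.2])

lemma expMeasure_absolutelyContinuous (γ T : ℝ) : expMeasure γ T ≪ μT T :=
  withDensity_absolutelyContinuous _ _

lemma absolutelyContinuous_expMeasure {γ : ℝ} (hγ : 0 ≤ γ) (T : ℝ) : μT T ≪ expMeasure γ T :=
  Measure.absolutelyContinuous_of_le_smul (le_expMeasure hγ)

instance (γ T : ℝ) : IsFiniteMeasure (expMeasure γ T) := by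
  refine ⟨?_⟩
  rw [expMeasure, withDensity_apply _ MeasurableSet.univ, Measure.restrict_univ]
  have hle : ∀ᵐ t ∂(μT T), (Real.toNNReal (Real.exp (-(2 * γ * t))) : ℝ≥0∞)
      ≤ ENNReal.ofReal (Real.exp (2 * |γ| * |T|)) := by
    filter_upwards [ae_mem_Ioo T] with t ht
    rw [coe_toNNReal_eq_ofReal]
    refine ENNReal.ofReal_le_ofReal (Real.exp_le_exp.2 ?_)
    have h1 : |γ * t| ≤ |γ| * |T| := by
      rw [abs_mul]
      refine mul_le_mul_of_nonneg_left ?_ (abs_nonneg γ)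
      rw [abs_of_pos ht.1]
      exact ht.2.le.trans (le_abs_self T)
    have := neg_abs_le (γ * t)
    linarith
  refine (lintegral_mono_ae hle).trans_lt ?_
  rw [lintegral_const]
  exact ENNReal.mul_lt_top ENNReal.ofReal_lt_top (measure_lt_top _ _)

section Normed

variable {E : Type*} [NormedAddCommGroup E]

lemma memLp_of_expMeasure {γ T : ℝ} (hγ : 0 ≤ γ) {p : ℝ≥0∞} {f : ℝ → E}
    (hf : MemLp f p (expMeasure γ T)) : MemLp f p (μT T) :=
  hf.of_measure_le_smul ENNReal.ofReal_ne_top (le_expMeasure hγ)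

lemma memLp_expMeasure {γ T : ℝ} (hγ : 0 ≤ γ) {p : ℝ≥0∞} {f : ℝ → E}
    (hf : MemLp f p (μT T)) : MemLp f p (expMeasure γ T) :=
  hf.of_measure_le_smul ENNReal.one_ne_top (expMeasure_le hγ)

lemma intervalIntegrable_of_memLp {T : ℝ} {f : ℝ → E} (hf : MemLp f 2 (μT T)) {t : ℝ}
    (ht : t ∈ Icc 0 T) : IntervalIntegrable f volume 0 t := by
  rw [intervalIntegrable_iff_integrableOn_Ioo_of_le ht.1]
  exact IntegrableOn.mono_set (hf.integrable (by norm_num)) (Ioo_subset_Ioo_right ht.2)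

end Normed

lemma integral_expMeasure {E : Type*} [NormedAddCommGroup E] [NormedSpace ℝ E] {γ T : ℝ}
    (hT : 0 ≤ T) (g : ℝ → E) :
    ∫ t, g t ∂(expMeasure γ T) = ∫ t in (0 : ℝ)..T, Real.exp (-(2 * γ * t)) • g t := by
  rw [expMeasure, integral_withDensity_eq_integral_smul (by fun_prop),
    intervalIntegral.integral_of_le hT, integral_Ioc_eq_integral_Ioo]
  refine integral_congr_ae (Filter.Eventually.of_forall fun t => ?_)
  simp only [NNReal.smul_def, Real.coe_toNNReal _ (Real.exp_pos _).le]

/-! ### The Volterra operator -/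

section Volterra

variable {H : Type*} [NormedAddCommGroup H] [NormedSpace ℝ H]

/-- A bound for the Volterra operator on `L²(e^{-2γt}dt)`, in terms of `γ` and `T`. -/
def volterraBound (γ T : ℝ) : ℝ :=
  (ENNReal.ofReal (Real.exp (2 * γ * T)) ^ (1 / (2 : ℝ≥0∞)).toReal *
    (μT T) univ ^ (1 / (1 : ℝ≥0∞).toReal - 1 / (2 : ℝ≥0∞).toReal)).toReal

lemma norm_primitive_le {γ T : ℝ} (hγ : 0 ≤ γ) (f : Lp H 2 (expMeasure γ T)) {t : ℝ}
    (ht : t ∈ Icc 0 T) : ‖∫ s in (0 : ℝ)..t, f s‖ ≤ volterraBound γ T * ‖f‖ := by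
  have hf : MemLp f 2 (μT T) := memLp_of_expMeasure hγ (Lp.memLp f)
  have hi : Integrable f (μT T) := hf.integrable (by norm_num)
  calc ‖∫ s in (0 : ℝ)..t, f s‖ ≤ ∫ s in (0 : ℝ)..t, ‖f s‖ :=
        intervalIntegral.norm_integral_le_integral_norm ht.1
    _ ≤ ∫ s, ‖f s‖ ∂(μT T) := by
        rw [intervalIntegral.integral_of_le ht.1, integral_Ioc_eq_integral_Ioo]
        exact setIntegral_mono_set hi.norm (Filter.Eventually.of_forall fun _ => norm_nonneg _)
          (Ioo_subset_Ioo_right ht.2).eventuallyLE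
    _ = (eLpNorm f 1 (μT T)).toReal := by
        rw [integral_norm_eq_lintegral_enorm hi.aestronglyMeasurable,
          eLpNorm_one_eq_lintegral_enorm]
    _ ≤ volterraBound γ T * ‖f‖ := by
        rw [volterraBound, Lp.norm_def, ← ENNReal.toReal_mul]
        refine ENNReal.toReal_mono ?_ ?_
        · refine ENNReal.mul_ne_top (ENNReal.mul_ne_top ?_ ?_) (Lp.memLp f).eLpNorm_ne_top
          · exact ENNReal.rpow_ne_top_of_nonneg (by positivity) ENNReal.ofReal_ne_top
          · exact ENNReal.rpow_ne_top_of_nonneg (by norm_num) (measure_ne_top _ _)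
        · refine (eLpNorm_le_eLpNorm_mul_rpow_measure_univ (q := 2) (by norm_num)
            hf.aestronglyMeasurable).trans ?_
          rw [mul_right_comm]
          gcongr
          exact eLpNorm_le_of_measure_le_smul (le_expMeasure hγ)

lemma continuousOn_primitive {T : ℝ} (hT : 0 ≤ T) {f : ℝ → H} (hf : MemLp f 2 (μT T)) :
    ContinuousOn (fun t => ∫ s in (0 : ℝ)..t, f s) (Icc 0 T) := by
  have h := intervalIntegral.continuousOn_primitive_interval (μ := volume) (f := f) (a := 0)
    (b := T) (by
      rw [uIcc_of_le hT, integrableOn_Icc_iff_integrableOn_Ioo]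
      exact hf.integrable (by norm_num))
  rwa [uIcc_of_le hT] at h

lemma memLp_primitive {γ T : ℝ} (hT : 0 ≤ T) (hγ : 0 ≤ γ) (f : Lp H 2 (expMeasure γ T)) :
    MemLp (fun t => ∫ s in (0 : ℝ)..t, f s) 2 (expMeasure γ T) := by
  refine memLp_expMeasure hγ (MemLp.of_bound ?_ (volterraBound γ T * ‖f‖) ?_)
  · exact ((continuousOn_primitive hT (memLp_of_expMeasure hγ (Lp.memLp f))).mono
      Ioo_subset_Icc_self).aestronglyMeasurable measurableSet_Ioo
  · filter_upwards [ae_mem_Ioo T] with t ht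
    exact norm_primitive_le hγ f (Ioo_subset_Icc_self ht)

lemma ae_expMeasure_mem_Ioo (γ T : ℝ) : ∀ᵐ t ∂(expMeasure γ T), t ∈ Ioo 0 T :=
  (expMeasure_absolutelyContinuous γ T).ae_le (ae_mem_Ioo T)

lemma primitive_congr {T : ℝ} {f g : ℝ → H} (h : f =ᵐ[μT T] g) {t : ℝ}
    (ht : t ∈ Icc 0 T) : ∫ s in (0 : ℝ)..t, f s = ∫ s in (0 : ℝ)..t, g s := by
  rw [intervalIntegral.integral_of_le ht.1, intervalIntegral.integral_of_le ht.1,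
    integral_Ioc_eq_integral_Ioo, integral_Ioc_eq_integral_Ioo]
  exact integral_congr_ae (ae_restrict_of_ae_restrict_of_subset (Ioo_subset_Ioo_right ht.2) h)

/-- The Volterra operator `f ↦ (t ↦ ∫₀ᵗ f)` on `L²(0,T;H)` with the weight `e^{-2γt}`. -/
def volterra {γ T : ℝ} (hT : 0 ≤ T) (hγ : 0 ≤ γ) :
    Lp H 2 (expMeasure γ T) →L[ℝ] Lp H 2 (expMeasure γ T) :=
  LinearMap.mkContinuous
    { toFun := fun f => (memLp_primitive hT hγ f).toLp _
      map_add' := fun f g => by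
        rw [← MemLp.toLp_add]
        refine MemLp.toLp_congr _ _ ?_
        filter_upwards [ae_expMeasure_mem_Ioo γ T] with t ht
        have ht' := Ioo_subset_Icc_self ht
        rw [primitive_congr ((absolutelyContinuous_expMeasure hγ T).ae_le (Lp.coeFn_add f g)) ht']
        simp only [Pi.add_apply]
        exact intervalIntegral.integral_add
          (intervalIntegrable_of_memLp (memLp_of_expMeasure hγ (Lp.memLp f)) ht')
          (intervalIntegrable_of_memLp (memLp_of_expMeasure hγ (Lp.memLp g)) ht')
      map_smul' := fun c f => by
        rw [RingHom.id_apply, ← MemLp.toLp_const_smul]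
        refine MemLp.toLp_congr _ _ ?_
        filter_upwards [ae_expMeasure_mem_Ioo γ T] with t ht
        rw [primitive_congr ((absolutelyContinuous_expMeasure hγ T).ae_le (Lp.coeFn_smul c f))
          (Ioo_subset_Icc_self ht)]
        simp only [Pi.smul_apply]
        exact intervalIntegral.integral_smul c _ }
    (↑(measureUnivNNReal (expMeasure γ T)) ^ (2 : ℝ≥0∞).toReal⁻¹ * volterraBound γ T)
    fun f => by
      rw [mul_assoc]
      refine Lp.norm_le_of_ae_bound
        (mul_nonneg ENNReal.toReal_nonneg (norm_nonneg _)) ?_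
      filter_upwards [ae_expMeasure_mem_Ioo γ T, (memLp_primitive hT hγ f).coeFn_toLp]
        with t ht h
      simp only [LinearMap.coe_mk, AddHom.coe_mk]
      rw [h]
      exact norm_primitive_le hγ f (Ioo_subset_Icc_self ht)

lemma coeFn_volterra {γ T : ℝ} (hT : 0 ≤ T) (hγ : 0 ≤ γ) (f : Lp H 2 (expMeasure γ T)) :
    volterra hT hγ f =ᵐ[expMeasure γ T] fun t => ∫ s in (0 : ℝ)..t, f s :=
  (memLp_primitive hT hγ f).coeFn_toLp

lemma coeFn_constL (γ T : ℝ) (w₀ : H) :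
    Lp.constL 2 (expMeasure γ T) ℝ w₀ =ᵐ[expMeasure γ T] fun _ => w₀ :=
  Lp.coeFn_const 2 (expMeasure γ T) w₀

end Volterra

/-! ### The weighted energy inequality -/

section Energy

variable {H : Type*} [NormedAddCommGroup H] [InnerProductSpace ℝ H]

/-- The element `t ↦ w₀ + ∫₀ᵗ k` of `L²(0,T;H)`. -/
def primitiveFrom {γ T : ℝ} (hT : 0 ≤ T) (hγ : 0 ≤ γ) (w₀ : H) (k : Lp H 2 (expMeasure γ T)) :
    Lp H 2 (expMeasure γ T) :=
  Lp.constL 2 (expMeasure γ T) ℝ w₀ + volterra hT hγ k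

lemma coeFn_primitiveFrom {γ T : ℝ} (hT : 0 ≤ T) (hγ : 0 ≤ γ) (w₀ : H)
    (k : Lp H 2 (expMeasure γ T)) :
    primitiveFrom hT hγ w₀ k =ᵐ[expMeasure γ T] fun t => w₀ + ∫ s in (0 : ℝ)..t, k s := by
  filter_upwards [Lp.coeFn_add (Lp.constL 2 (expMeasure γ T) ℝ w₀) (volterra hT hγ k),
    coeFn_constL γ T w₀, coeFn_volterra hT hγ k] with t h1 h2 h3
  rw [primitiveFrom, h1, Pi.add_apply, h2, h3]

variable [CompleteSpace H]

/-- The weighted energy inequality for a continuous time derivative `g`, by the fundamental theorem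
of calculus for `½ e^{-2γt} ⟪S w, w⟫`. -/
lemma energy_inequality_of_continuous {γ T : ℝ} (hT : 0 ≤ T) {S : H →L[ℝ] H}
    (hS : ∀ x y, ⟪S x, y⟫ = ⟪x, S y⟫) (hpos : ∀ x, 0 ≤ ⟪S x, x⟫) (w₀ : H) {g w : ℝ → H}
    (hg : Continuous g) (hw : w = fun t => w₀ + ∫ s in (0 : ℝ)..t, g s) :
    γ * (∫ t, ⟪S (w t), w t⟫ ∂(expMeasure γ T)) - 1 / 2 * ⟪S w₀, w₀⟫
      ≤ ∫ t, ⟪S (w t), g t⟫ ∂(expMeasure γ T) := by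
  have hd : ∀ t, HasDerivAt w (g t) t := fun t => by
    rw [hw]
    exact (intervalIntegral.integral_hasDerivAt_right (hg.intervalIntegrable _ _)
      (hg.stronglyMeasurableAtFilter _ _) hg.continuousAt).const_add w₀
  have hwc : Continuous w := continuous_iff_continuousAt.2 fun t => (hd t).continuousAt
  have h0 : w 0 = w₀ := by simp [hw]
  have hφ : ∀ t, HasDerivAt (fun t => 1 / 2 * (Real.exp (-(2 * γ * t)) * ⟪S (w t), w t⟫))
      (Real.exp (-(2 * γ * t)) * ⟪S (w t), g t⟫
        - γ * (Real.exp (-(2 * γ * t)) * ⟪S (w t), w t⟫)) t := fun t => by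
    have h1 : HasDerivAt (fun t => Real.exp (-(2 * γ * t)))
        (Real.exp (-(2 * γ * t)) * (-(2 * γ))) t := by
      have := ((hasDerivAt_id t).const_mul (2 * γ)).neg.exp
      simpa using this
    have h2 : HasDerivAt (fun t => ⟪S (w t), w t⟫) (⟪S (w t), g t⟫ + ⟪S (g t), w t⟫) t :=
      (S.hasFDerivAt.comp_hasDerivAt t (hd t)).inner ℝ (hd t)
    have h3 : ⟪S (g t), w t⟫ = ⟪S (w t), g t⟫ := by rw [hS, real_inner_comm]
    convert! (h1.mul h2).const_mul (1 / 2) using 1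
    rw [h3]
    ring
  have hFTC := intervalIntegral.integral_eq_sub_of_hasDerivAt (a := 0) (b := T)
    (fun t _ => hφ t) (Continuous.intervalIntegrable (by fun_prop) _ _)
  rw [intervalIntegral.integral_sub (Continuous.intervalIntegrable (by fun_prop) _ _)
    (Continuous.intervalIntegrable (by fun_prop) _ _), intervalIntegral.integral_const_mul,
    h0] at hFTC
  rw [integral_expMeasure hT, integral_expMeasure hT]
  simp only [smul_eq_mul]
  have hTpos : 0 ≤ Real.exp (-(2 * γ * T)) * ⟪S (w T), w T⟫ :=
    mul_nonneg (Real.exp_pos _).le (hpos _)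
  simp only [mul_zero, neg_zero, Real.exp_zero, one_mul] at hFTC
  linarith

/-- The weighted energy inequality: `d/dt ½⟪S w, w⟫ = ⟪S w, w'⟫` for `w = w₀ + ∫₀ᵗ k`, integrated
against `e^{-2γt}`; the boundary term at `T` is dropped. -/
theorem energy_inequality {γ T : ℝ} (hT : 0 ≤ T) (hγ : 0 ≤ γ) {S : H →L[ℝ] H}
    (hS : ∀ x y, ⟪S x, y⟫ = ⟪x, S y⟫) (hpos : ∀ x, 0 ≤ ⟪S x, x⟫) (w₀ : H)
    (k : Lp H 2 (expMeasure γ T)) :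
    γ * ⟪S.compLpL 2 (expMeasure γ T) (primitiveFrom hT hγ w₀ k), primitiveFrom hT hγ w₀ k⟫
      - 1 / 2 * ⟪S w₀, w₀⟫
      ≤ ⟪S.compLpL 2 (expMeasure γ T) (primitiveFrom hT hγ w₀ k), k⟫ := by
  have hc : Continuous fun k : Lp H 2 (expMeasure γ T) => primitiveFrom hT hγ w₀ k := by
    unfold primitiveFrom
    fun_prop
  refine (BoundedContinuousFunction.toLp_denseRange H (expMeasure γ T) (p := 2) ℝ
    (by norm_num)).induction_on
    (p := fun k => γ * ⟪S.compLpL 2 (expMeasure γ T) (primitiveFrom hT hγ w₀ k),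
      primitiveFrom hT hγ w₀ k⟫ - 1 / 2 * ⟪S w₀, w₀⟫
      ≤ ⟪S.compLpL 2 (expMeasure γ T) (primitiveFrom hT hγ w₀ k), k⟫) k ?_ ?_
  · exact isClosed_le (by fun_prop) (by fun_prop)
  · intro g
    set G := BoundedContinuousFunction.toLp 2 (expMeasure γ T) ℝ g with hG
    have hGg : G =ᵐ[expMeasure γ T] g :=
      BoundedContinuousFunction.coeFn_toLp 2 (expMeasure γ T) ℝ g
    set w : ℝ → H := fun t => w₀ + ∫ s in (0 : ℝ)..t, g s with hw
    have hW : primitiveFrom hT hγ w₀ G =ᵐ[expMeasure γ T] w := by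
      filter_upwards [coeFn_primitiveFrom hT hγ w₀ G, ae_expMeasure_mem_Ioo γ T] with t h1 h2
      rw [h1, hw, primitive_congr ((absolutelyContinuous_expMeasure hγ T).ae_le hGg)
        (Ioo_subset_Icc_self h2)]
    have hSW := S.coeFn_compLpL (p := 2) (primitiveFrom hT hγ w₀ G)
    rw [L2.inner_def, L2.inner_def]
    have e1 : ∫ t, ⟪S.compLpL 2 (expMeasure γ T) (primitiveFrom hT hγ w₀ G) t,
        primitiveFrom hT hγ w₀ G t⟫ ∂(expMeasure γ T)
        = ∫ t, ⟪S (w t), w t⟫ ∂(expMeasure γ T) := by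
      refine integral_congr_ae ?_
      filter_upwards [hSW, hW] with t h1 h2
      rw [h1, h2]
    have e2 : ∫ t, ⟪S.compLpL 2 (expMeasure γ T) (primitiveFrom hT hγ w₀ G) t, G t⟫
        ∂(expMeasure γ T) = ∫ t, ⟪S (w t), g t⟫ ∂(expMeasure γ T) := by
      refine integral_congr_ae ?_
      filter_upwards [hSW, hW, hGg] with t h1 h2 h3
      rw [h1, h2, h3]
    rw [e1, e2]
    exact energy_inequality_of_continuous hT hS hpos w₀ g.continuous hw

end Energy

/-! ### The abstract evolution equation -/

section IsMul

variable {H : Type*} [NormedAddCommGroup H] [InnerProductSpace ℝ H] {γ T : ℝ} {b : ℝ → ℝ}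
  {b₀ M : ℝ}

/-- `β` is the multiplication by `b(t)`, with `b₀ ≤ b ≤ M`, on `L²(0,T;H)`. -/
structure IsMul (b₀ M : ℝ) (b : ℝ → ℝ)
    (β : Lp H 2 (expMeasure γ T) →L[ℝ] Lp H 2 (expMeasure γ T)) : Prop where
  coeFn : ∀ f, β f =ᵐ[expMeasure γ T] fun t => b t • f t
  lower : ∀ᵐ t ∂(expMeasure γ T), b₀ ≤ b t
  upper : ∀ᵐ t ∂(expMeasure γ T), b t ≤ M

variable {β : Lp H 2 (expMeasure γ T) →L[ℝ] Lp H 2 (expMeasure γ T)}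

lemma IsMul.symm (hβ : IsMul b₀ M b β) (f g : Lp H 2 (expMeasure γ T)) :
    ⟪f, β g⟫ = ⟪β f, g⟫ := by
  rw [L2.inner_def, L2.inner_def]
  refine integral_congr_ae ?_
  filter_upwards [hβ.coeFn f, hβ.coeFn g] with t h1 h2
  rw [h1, h2, real_inner_smul_left, real_inner_smul_right]

lemma IsMul.le_inner (hβ : IsMul b₀ M b β) (f : Lp H 2 (expMeasure γ T)) :
    b₀ * ‖f‖ ^ 2 ≤ ⟪β f, f⟫ := by
  rw [← real_inner_self_eq_norm_sq, L2.inner_def, L2.inner_def, ← integral_const_mul]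
  refine integral_mono_ae ((L2.integrable_inner f f).const_mul _) (L2.integrable_inner _ _) ?_
  filter_upwards [hβ.coeFn f, hβ.lower] with t h1 h2
  rw [h1, real_inner_smul_left]
  exact mul_le_mul_of_nonneg_right h2 real_inner_self_nonneg

lemma IsMul.norm_le (hb₀ : 0 < b₀) (hβ : IsMul b₀ M b β) (f : Lp H 2 (expMeasure γ T)) :
    ‖β f‖ ≤ M * ‖f‖ := by
  refine Lp.norm_le_mul_norm_of_ae_le_mul ?_
  filter_upwards [hβ.coeFn f, hβ.lower, hβ.upper] with t h1 h2 h3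
  rw [h1, norm_smul, Real.norm_of_nonneg (hb₀.le.trans h2)]
  gcongr

end IsMul

section Abstract

variable {H V : Type*} [NormedAddCommGroup H] [InnerProductSpace ℝ H] [CompleteSpace H]
  [NormedAddCommGroup V] [InnerProductSpace ℝ V] [CompleteSpace V]
  {γ T : ℝ} {b : ℝ → ℝ} {b₀ M : ℝ}

/-- The operator `J = π π†`. If `π : V → H` is the inclusion of the form domain of a nonnegative
self-adjoint operator `A` (with the graph norm on `V`), then `J = (1 + A)⁻¹`, with values in the
domain of `A`, and `A (J w) = w - J w`. -/
def resolvent (π : V →L[ℝ] H) : H →L[ℝ] H := π ∘L adjoint π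

lemma inner_resolvent (π : V →L[ℝ] H) (x y : H) :
    ⟪resolvent π x, y⟫ = ⟪adjoint π x, adjoint π y⟫ := by
  rw [resolvent, ContinuousLinearMap.comp_apply, ContinuousLinearMap.adjoint_inner_right]

lemma resolvent_symm (π : V →L[ℝ] H) (x y : H) :
    ⟪resolvent π x, y⟫ = ⟪x, resolvent π y⟫ := by
  rw [inner_resolvent, real_inner_comm, ← inner_resolvent, real_inner_comm]

lemma norm_adjoint_apply_le {π : V →L[ℝ] H} (hπ : ∀ v, ‖π v‖ ≤ ‖v‖) (x : H) :
    ‖adjoint π x‖ ≤ ‖x‖ := by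
  have h1 : ‖π‖ ≤ 1 := π.opNorm_le_bound zero_le_one fun v => by simpa using hπ v
  calc ‖adjoint π x‖ ≤ ‖adjoint π‖ * ‖x‖ := (adjoint π).le_opNorm x
    _ ≤ 1 * ‖x‖ := by
      gcongr
      rwa [LinearIsometryEquiv.norm_map]
    _ = ‖x‖ := one_mul _

lemma inner_resolvent_compLp (π : V →L[ℝ] H) (f g : Lp H 2 (expMeasure γ T)) :
    ⟪(resolvent π).compLpL 2 (expMeasure γ T) f, g⟫ =
      ⟪(adjoint π).compLpL 2 (expMeasure γ T) f, (adjoint π).compLpL 2 (expMeasure γ T) g⟫ := by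
  rw [L2.inner_def, L2.inner_def]
  refine integral_congr_ae ?_
  filter_upwards [(resolvent π).coeFn_compLpL (p := 2) f, (adjoint π).coeFn_compLpL (p := 2) f,
    (adjoint π).coeFn_compLpL (p := 2) g] with t h1 h2 h3
  rw [h1, h2, h3, inner_resolvent]

section

variable {β : Lp H 2 (expMeasure γ T) →L[ℝ] Lp H 2 (expMeasure γ T)}

lemma IsMul.inner_resolvent_le (hβ : IsMul b₀ M b β) (π : V →L[ℝ] H)
    (f : Lp H 2 (expMeasure γ T)) :
    ⟪β ((resolvent π).compLpL 2 (expMeasure γ T) f), f⟫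
      ≤ M * ‖(adjoint π).compLpL 2 (expMeasure γ T) f‖ ^ 2 := by
  rw [← real_inner_self_eq_norm_sq, L2.inner_def, L2.inner_def, ← integral_const_mul]
  refine integral_mono_ae (L2.integrable_inner _ _) ((L2.integrable_inner _ _).const_mul _) ?_
  filter_upwards [hβ.coeFn ((resolvent π).compLpL 2 (expMeasure γ T) f), hβ.upper,
    (resolvent π).coeFn_compLpL (p := 2) f, (adjoint π).coeFn_compLpL (p := 2) f]
    with t h1 h2 h3 h4
  rw [h1, h3, h4, real_inner_smul_left, inner_resolvent]
  exact mul_le_mul_of_nonneg_right h2 real_inner_self_nonneg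

lemma IsMul.le_inner_resolvent (hβ : IsMul b₀ M b β) (π : V →L[ℝ] H)
    (f : Lp H 2 (expMeasure γ T)) :
    b₀ * ‖(adjoint π).compLpL 2 (expMeasure γ T) f‖ ^ 2
      ≤ ⟪f, (resolvent π).compLpL 2 (expMeasure γ T) (β f)⟫ := by
  rw [← real_inner_self_eq_norm_sq, L2.inner_def, L2.inner_def, ← integral_const_mul]
  refine integral_mono_ae ((L2.integrable_inner _ _).const_mul _) (L2.integrable_inner _ _) ?_
  filter_upwards [hβ.coeFn f, hβ.lower, (resolvent π).coeFn_compLpL (p := 2) (β f),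
    (adjoint π).coeFn_compLpL (p := 2) f] with t h1 h2 h3 h4
  rw [h3, h1, h4, map_smul, real_inner_smul_right, ← resolvent_symm, inner_resolvent]
  exact mul_le_mul_of_nonneg_right h2 real_inner_self_nonneg

end

/-- `(w₀, k) ↦ (π† w₀, u', w)` with `w = w₀ + ∫₀ᵗ k` and `u = J w`: the trajectories `u` that are
regular enough for the energy identity. -/
def trajectory (hT : 0 ≤ T) (hγ : 0 ≤ γ) (π : V →L[ℝ] H) :
    H × Lp H 2 (expMeasure γ T) →L[ℝ]
      V × Lp H 2 (expMeasure γ T) × Lp H 2 (expMeasure γ T) :=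
  ((adjoint π) ∘L ContinuousLinearMap.fst ℝ _ _).prod
    (((resolvent π).compLpL 2 (expMeasure γ T) ∘L ContinuousLinearMap.snd ℝ _ _).prod
      (Lp.constL 2 (expMeasure γ T) ℝ ∘L ContinuousLinearMap.fst ℝ _ _ +
        volterra hT hγ ∘L ContinuousLinearMap.snd ℝ _ _))

lemma trajectory_apply (hT : 0 ≤ T) (hγ : 0 ≤ γ) (π : V →L[ℝ] H) (w₀ : H)
    (k : Lp H 2 (expMeasure γ T)) :
    trajectory hT hγ π (w₀, k) = (adjoint π w₀,
      (resolvent π).compLpL 2 (expMeasure γ T) k, primitiveFrom hT hγ w₀ k) := rfl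

/-- The closure of the set of regular trajectories. A triple `(v₀, u', w)` in it encodes a function
`u = J w` with `u + A u = w ∈ L²(0,T;H)`, time derivative `u' ∈ L²(0,T;H)` and `u(0) = π v₀`. -/
def solutionSpace (hT : 0 ≤ T) (hγ : 0 ≤ γ) (π : V →L[ℝ] H) :
    Submodule ℝ (V × Lp H 2 (expMeasure γ T) × Lp H 2 (expMeasure γ T)) :=
  (trajectory hT hγ π).range.topologicalClosure

lemma solutionSpace_induction {hT : 0 ≤ T} {hγ : 0 ≤ γ} {π : V →L[ℝ] H}
    {p : V × Lp H 2 (expMeasure γ T) × Lp H 2 (expMeasure γ T) → Prop}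
    (hcl : IsClosed {z | p z}) (h : ∀ w₀ k, p (trajectory hT hγ π (w₀, k)))
    {z : V × Lp H 2 (expMeasure γ T) × Lp H 2 (expMeasure γ T)}
    (hz : z ∈ solutionSpace hT hγ π) : p z := by
  have hsub : ((trajectory hT hγ π).range : Set _) ⊆ {z | p z} := by
    rintro _ ⟨⟨w₀, k⟩, rfl⟩
    exact h w₀ k
  exact closure_minimal hsub hcl hz

lemma trajectory_mem (hT : 0 ≤ T) (hγ : 0 ≤ γ) (π : V →L[ℝ] H) (x) :
    trajectory hT hγ π x ∈ solutionSpace hT hγ π :=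
  Submodule.le_topologicalClosure _ ⟨x, rfl⟩

/-- `u = J w` is the primitive of `u'` that starts at `π v₀`. -/
lemma resolvent_eq_primitiveFrom {hT : 0 ≤ T} {hγ : 0 ≤ γ} {π : V →L[ℝ] H}
    {z : V × Lp H 2 (expMeasure γ T) × Lp H 2 (expMeasure γ T)}
    (hz : z ∈ solutionSpace hT hγ π) :
    (resolvent π).compLpL 2 (expMeasure γ T) z.2.2 = primitiveFrom hT hγ (π z.1) z.2.1 := by
  refine solutionSpace_induction (p := fun z => (resolvent π).compLpL 2 (expMeasure γ T) z.2.2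
    = primitiveFrom hT hγ (π z.1) z.2.1) (isClosed_eq (by fun_prop) ?_) ?_ hz
  · unfold primitiveFrom
    fun_prop
  · intro w₀ k
    rw [trajectory_apply]
    ext1
    filter_upwards [(resolvent π).coeFn_compLpL (p := 2) (primitiveFrom hT hγ w₀ k),
      coeFn_primitiveFrom hT hγ w₀ k,
      coeFn_primitiveFrom hT hγ (π (adjoint π w₀)) ((resolvent π).compLpL 2 (expMeasure γ T) k),
      ae_expMeasure_mem_Ioo γ T] with t h1 h2 h3 ht
    have ht' := Ioo_subset_Icc_self ht
    rw [h1, h2, h3, map_add, primitive_congr ((absolutelyContinuous_expMeasure hγ T).ae_le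
      ((resolvent π).coeFn_compLpL (p := 2) k)) ht',
      (resolvent π).intervalIntegral_comp_comm
        (intervalIntegrable_of_memLp (memLp_of_expMeasure hγ (Lp.memLp k)) ht')]
    rfl

/-- The operator `u ↦ (u' + b A u, u(0))`. -/
def parabolicOp (π : V →L[ℝ] H)
    (β : Lp H 2 (expMeasure γ T) →L[ℝ] Lp H 2 (expMeasure γ T)) :
    V × Lp H 2 (expMeasure γ T) × Lp H 2 (expMeasure γ T) →L[ℝ]
      Lp H 2 (expMeasure γ T) × V :=
  let w := ContinuousLinearMap.snd ℝ (Lp H 2 (expMeasure γ T)) (Lp H 2 (expMeasure γ T)) ∘L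
    ContinuousLinearMap.snd ℝ V (Lp H 2 (expMeasure γ T) × Lp H 2 (expMeasure γ T))
  (ContinuousLinearMap.fst ℝ _ _ ∘L ContinuousLinearMap.snd ℝ _ _ +
    β ∘L (w - (resolvent π).compLpL 2 (expMeasure γ T) ∘L w)).prod (ContinuousLinearMap.fst ℝ _ _)

lemma parabolicOp_apply (π : V →L[ℝ] H)
    (β : Lp H 2 (expMeasure γ T) →L[ℝ] Lp H 2 (expMeasure γ T))
    (z : V × Lp H 2 (expMeasure γ T) × Lp H 2 (expMeasure γ T)) :
    parabolicOp π β z =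
      (z.2.1 + β (z.2.2 - (resolvent π).compLpL 2 (expMeasure γ T) z.2.2), z.1) := rfl

variable {β : Lp H 2 (expMeasure γ T) →L[ℝ] Lp H 2 (expMeasure γ T)}

/-- The energy estimate, from the multiplier `w = u + A u`. -/
theorem energy_estimate (hT : 0 ≤ T) (hγ : 0 ≤ γ) (hb₀ : 0 < b₀) (hβ : IsMul b₀ M b β)
    {π : V →L[ℝ] H} {z : V × Lp H 2 (expMeasure γ T) × Lp H 2 (expMeasure γ T)}
    (hz : z ∈ solutionSpace hT hγ π) :
    (γ - M) * ‖(adjoint π).compLpL 2 (expMeasure γ T) z.2.2‖ ^ 2 + b₀ / 2 * ‖z.2.2‖ ^ 2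
      ≤ 1 / 2 * ‖z.1‖ ^ 2 + 1 / (2 * b₀) * ‖(parabolicOp π β z).1‖ ^ 2 := by
  refine solutionSpace_induction (p := fun z =>
    (γ - M) * ‖(adjoint π).compLpL 2 (expMeasure γ T) z.2.2‖ ^ 2 + b₀ / 2 * ‖z.2.2‖ ^ 2
      ≤ 1 / 2 * ‖z.1‖ ^ 2 + 1 / (2 * b₀) * ‖(parabolicOp π β z).1‖ ^ 2)
    (isClosed_le (by fun_prop) (by fun_prop)) ?_ hz
  intro w₀ k
  rw [trajectory_apply, parabolicOp_apply]
  dsimp only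
  set w := primitiveFrom hT hγ w₀ k
  set Jk := (resolvent π).compLpL 2 (expMeasure γ T) k with hJk
  set Jw := (resolvent π).compLpL 2 (expMeasure γ T) w with hJw
  set Dw := (adjoint π).compLpL 2 (expMeasure γ T) w with hDw
  set F := Jk + β (w - Jw) with hF
  have h1 := energy_inequality hT hγ (resolvent_symm π)
    (fun x => by rw [inner_resolvent]; exact real_inner_self_nonneg) w₀ k
  have h2 : ⟪Jw, w⟫ = ‖Dw‖ ^ 2 := by
    rw [hJw, inner_resolvent_compLp, real_inner_self_eq_norm_sq]
  have h3 : ⟪Jw, k⟫ = ⟪Jk, w⟫ := by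
    rw [hJw, hJk, inner_resolvent_compLp, inner_resolvent_compLp, real_inner_comm]
  have h4 : ⟪resolvent π w₀, w₀⟫ = ‖adjoint π w₀‖ ^ 2 := by
    rw [inner_resolvent, real_inner_self_eq_norm_sq]
  have h5 := hβ.le_inner w
  have h6 := hβ.inner_resolvent_le π w
  have h7 : ⟪F, w⟫ = ⟪Jk, w⟫ + ⟪β w, w⟫ - ⟪β Jw, w⟫ := by
    rw [hF, map_sub, inner_add_left, inner_sub_left]
    ring
  have h8 : ⟪F, w⟫ ≤ ‖F‖ * ‖w‖ := real_inner_le_norm F w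
  have h9 : ‖F‖ * ‖w‖ ≤ b₀ / 2 * ‖w‖ ^ 2 + 1 / (2 * b₀) * ‖F‖ ^ 2 := by
    have h := mul_nonneg (by positivity : 0 ≤ 1 / (2 * b₀)) (sq_nonneg (‖F‖ - b₀ * ‖w‖))
    have e : 1 / (2 * b₀) * (‖F‖ - b₀ * ‖w‖) ^ 2
        = b₀ / 2 * ‖w‖ ^ 2 + 1 / (2 * b₀) * ‖F‖ ^ 2 - ‖F‖ * ‖w‖ := by
      field_simp
      ring
    linarith
  change γ * ⟪Jw, w⟫ - 1 / 2 * ⟪resolvent π w₀, w₀⟫ ≤ ⟪Jw, k⟫ at h1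
  rw [h2, h3, h4] at h1
  linarith

/-- The range of `u ↦ (u' + b A u, u(0))` on `solutionSpace` is dense, since a `g` orthogonal to
`u' + b A u` for `u = J ∫₀ᵗ b g` satisfies `⟪g, J (b g)⟫ ≤ 0`. -/
theorem eq_zero_of_orthogonal (hT : 0 ≤ T) (hγ : 0 ≤ γ) (hb₀ : 0 < b₀) (hβ : IsMul b₀ M b β)
    {π : V →L[ℝ] H} (hπ : ∀ v, ‖π v‖ ≤ ‖v‖) (hD : ∀ w, adjoint π w = 0 → w = 0)
    (g : Lp H 2 (expMeasure γ T))
    (hg : ∀ k, ⟪g, (parabolicOp π β (trajectory hT hγ π (0, k))).1⟫ = 0) : g = 0 := by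
  set k := β g
  set w := primitiveFrom hT hγ 0 k with hw
  set S : H →L[ℝ] H := ContinuousLinearMap.id ℝ H - resolvent π with hS
  have hSc : S.compLpL 2 (expMeasure γ T) w
      = w - (resolvent π).compLpL 2 (expMeasure γ T) w := by
    ext1
    filter_upwards [S.coeFn_compLpL (p := 2) w, (resolvent π).coeFn_compLpL (p := 2) w,
      Lp.coeFn_sub w ((resolvent π).compLpL 2 (expMeasure γ T) w)] with t h1 h2 h3
    rw [h1, h3, Pi.sub_apply, h2]
    rfl
  have hpos : ∀ x, 0 ≤ ⟪S x, x⟫ := fun x => by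
    have e : ⟪S x, x⟫ = ‖x‖ ^ 2 - ‖adjoint π x‖ ^ 2 := by
      rw [hS, sub_apply, inner_sub_left, inner_resolvent,
        real_inner_self_eq_norm_sq, ContinuousLinearMap.id_apply, real_inner_self_eq_norm_sq]
    rw [e, sub_nonneg]
    gcongr
    exact norm_adjoint_apply_le hπ x
  have hsymm : ∀ x y, ⟪S x, y⟫ = ⟪x, S y⟫ := fun x y => by
    simp only [hS, sub_apply, ContinuousLinearMap.id_apply, inner_sub_left,
      inner_sub_right, resolvent_symm]
  have h1 := energy_inequality hT hγ hsymm hpos 0 k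
  have h2 : 0 ≤ ⟪S.compLpL 2 (expMeasure γ T) w, w⟫ := by
    rw [L2.inner_def]
    refine integral_nonneg_of_ae ?_
    filter_upwards [S.coeFn_compLpL (p := 2) w] with t h
    rw [h]
    exact hpos _
  have h3 := hβ.le_inner_resolvent π g
  have h4 := hg k
  rw [trajectory_apply, parabolicOp_apply] at h4
  dsimp only at h4
  rw [← hw, ← hSc, inner_add_right, hβ.symm, real_inner_comm] at h4
  rw [← hw, inner_zero_right, mul_zero, sub_zero] at h1
  have h5 : 0 ≤ γ * ⟪S.compLpL 2 (expMeasure γ T) w, w⟫ := mul_nonneg hγ h2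
  have h6 : ‖(adjoint π).compLpL 2 (expMeasure γ T) g‖ ^ 2 ≤ 0 := by
    rw [real_inner_comm g, real_inner_comm _ (β g)] at h4
    have : b₀ * ‖(adjoint π).compLpL 2 (expMeasure γ T) g‖ ^ 2 ≤ 0 := by linarith
    nlinarith
  have h7 : (adjoint π).compLpL 2 (expMeasure γ T) g = 0 := by
    rw [← norm_eq_zero]
    exact pow_eq_zero_iff (two_ne_zero) |>.1 (le_antisymm h6 (sq_nonneg _))
  ext1
  filter_upwards [(adjoint π).coeFn_compLpL (p := 2) g, Lp.coeFn_zero H 2 (expMeasure γ T),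
    Lp.coeFn_zero V 2 (expMeasure γ T)] with t h8 h9 h10
  rw [h9]
  refine hD _ ?_
  rw [← h8, h7, h10]
  rfl

end Abstract

/-! ### Maximal regularity and solvability of the abstract system -/

section AbstractSolvability

variable {H V : Type*} [NormedAddCommGroup H] [InnerProductSpace ℝ H] [CompleteSpace H]
  [NormedAddCommGroup V] [InnerProductSpace ℝ V] [CompleteSpace V]
  {γ T : ℝ} {b : ℝ → ℝ} {b₀ M : ℝ}
  {β : Lp H 2 (expMeasure γ T) →L[ℝ] Lp H 2 (expMeasure γ T)}

lemma norm_resolvent_compLp_le {π : V →L[ℝ] H} (hπ : ∀ v, ‖π v‖ ≤ ‖v‖)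
    (w : Lp H 2 (expMeasure γ T)) :
    ‖(resolvent π).compLpL 2 (expMeasure γ T) w‖ ≤ ‖w‖ := by
  refine Lp.norm_le_norm_of_ae_le ?_
  filter_upwards [(resolvent π).coeFn_compLpL (p := 2) w] with t h
  rw [h]
  exact (hπ _).trans (norm_adjoint_apply_le hπ _)

lemma norm_multiplier_le (hT : 0 ≤ T) (hγ : 0 ≤ γ) (hb₀ : 0 < b₀) (hMγ : M ≤ γ)
    (hβ : IsMul b₀ M b β) {π : V →L[ℝ] H}
    {z : V × Lp H 2 (expMeasure γ T) × Lp H 2 (expMeasure γ T)}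
    (hz : z ∈ solutionSpace hT hγ π) :
    ‖z.2.2‖ ≤ (1 + 1 / b₀) * ‖parabolicOp π β z‖ := by
  have h := energy_estimate hT hγ hb₀ hβ hz
  have h0 : ‖z.1‖ ≤ ‖parabolicOp π β z‖ := norm_snd_le (parabolicOp π β z)
  have h1 : ‖(parabolicOp π β z).1‖ ≤ ‖parabolicOp π β z‖ := norm_fst_le _
  have h2 : 0 ≤ (γ - M) * ‖(adjoint π).compLpL 2 (expMeasure γ T) z.2.2‖ ^ 2 :=
    mul_nonneg (sub_nonneg.2 hMγ) (sq_nonneg _)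
  set y := ‖parabolicOp π β z‖
  have h3 : b₀ / 2 * ‖z.2.2‖ ^ 2 ≤ 1 / 2 * y ^ 2 + 1 / (2 * b₀) * y ^ 2 := by
    have e1 : 1 / 2 * ‖z.1‖ ^ 2 ≤ 1 / 2 * y ^ 2 := by gcongr
    have e2 : 1 / (2 * b₀) * ‖(parabolicOp π β z).1‖ ^ 2 ≤ 1 / (2 * b₀) * y ^ 2 := by gcongr
    linarith
  refine abs_le_of_sq_le_sq' ?_ (by positivity) |>.2
  have h4 : ‖z.2.2‖ ^ 2 ≤ (1 / b₀ + 1 / b₀ * (1 / b₀)) * y ^ 2 := by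
    have := mul_le_mul_of_nonneg_left h3 (by positivity : 0 ≤ 2 / b₀)
    have e1 : 2 / b₀ * (b₀ / 2 * ‖z.2.2‖ ^ 2) = ‖z.2.2‖ ^ 2 := by field_simp
    have e2 : 2 / b₀ * (1 / 2 * y ^ 2 + 1 / (2 * b₀) * y ^ 2)
        = (1 / b₀ + 1 / b₀ * (1 / b₀)) * y ^ 2 := by field_simp
    linarith
  refine h4.trans ?_
  rw [mul_pow]
  gcongr
  have : 0 < 1 / b₀ := by positivity
  nlinarith

/-- For `γ` large, the form norm of the solution is small compared with the data. -/
lemma norm_formPart_le (hT : 0 ≤ T) (hγ : 0 ≤ γ) (hb₀ : 0 < b₀)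
    (hβ : IsMul b₀ M b β) {π : V →L[ℝ] H} {m : ℝ}
    (hMγ : M + (1 / 2 + 1 / (2 * b₀)) * m ^ 2 ≤ γ)
    {z : V × Lp H 2 (expMeasure γ T) × Lp H 2 (expMeasure γ T)}
    (hz : z ∈ solutionSpace hT hγ π) :
    m * ‖(adjoint π).compLpL 2 (expMeasure γ T) z.2.2‖ ≤ ‖parabolicOp π β z‖ := by
  have h := energy_estimate hT hγ hb₀ hβ hz
  have h0 : ‖z.1‖ ≤ ‖parabolicOp π β z‖ := norm_snd_le (parabolicOp π β z)
  have h1 : ‖(parabolicOp π β z).1‖ ≤ ‖parabolicOp π β z‖ := norm_fst_le _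
  set y := ‖parabolicOp π β z‖
  set d := ‖(adjoint π).compLpL 2 (expMeasure γ T) z.2.2‖
  have e1 : 1 / 2 * ‖z.1‖ ^ 2 ≤ 1 / 2 * y ^ 2 := by gcongr
  have e2 : 1 / (2 * b₀) * ‖(parabolicOp π β z).1‖ ^ 2 ≤ 1 / (2 * b₀) * y ^ 2 := by gcongr
  have e3 : 0 ≤ b₀ / 2 * ‖z.2.2‖ ^ 2 := by positivity
  have e4 : (1 / 2 + 1 / (2 * b₀)) * m ^ 2 * d ^ 2 ≤ (γ - M) * d ^ 2 := by
    gcongr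
    linarith
  have e5 : (1 / 2 + 1 / (2 * b₀)) * (m * d) ^ 2 ≤ (1 / 2 + 1 / (2 * b₀)) * y ^ 2 := by
    rw [mul_pow, ← mul_assoc]
    linarith
  have e6 := le_of_mul_le_mul_left e5 (by positivity)
  exact abs_le_of_sq_le_sq' e6 (norm_nonneg _) |>.2

lemma norm_timeDeriv_le (hT : 0 ≤ T) (hγ : 0 ≤ γ) (hb₀ : 0 < b₀) (hM : 0 ≤ M) (hMγ : M ≤ γ)
    (hβ : IsMul b₀ M b β) {π : V →L[ℝ] H} (hπ : ∀ v, ‖π v‖ ≤ ‖v‖)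
    {z : V × Lp H 2 (expMeasure γ T) × Lp H 2 (expMeasure γ T)}
    (hz : z ∈ solutionSpace hT hγ π) :
    ‖z.2.1‖ ≤ (1 + 2 * M * (1 + 1 / b₀)) * ‖parabolicOp π β z‖ := by
  have h1 : ‖(parabolicOp π β z).1‖ ≤ ‖parabolicOp π β z‖ := norm_fst_le _
  have h2 := norm_multiplier_le hT hγ hb₀ hMγ hβ hz
  set Jw := (resolvent π).compLpL 2 (expMeasure γ T) z.2.2 with hJw
  have h3 : ‖Jw‖ ≤ ‖z.2.2‖ := norm_resolvent_compLp_le hπ _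
  have e : z.2.1 = (parabolicOp π β z).1 - β (z.2.2 - Jw) := by
    rw [parabolicOp_apply, hJw, add_sub_cancel_right]
  have h4 : ‖β (z.2.2 - Jw)‖ ≤ M * (2 * ‖z.2.2‖) :=
    (hβ.norm_le hb₀ _).trans (mul_le_mul_of_nonneg_left ((norm_sub_le _ _).trans (by linarith)) hM)
  have h5 : ‖z.2.1‖ ≤ ‖(parabolicOp π β z).1‖ + ‖β (z.2.2 - Jw)‖ := by
    conv_lhs => rw [e]
    exact norm_sub_le _ _
  have h6 : M * (2 * ‖z.2.2‖) ≤ M * (2 * ((1 + 1 / b₀) * ‖parabolicOp π β z‖)) := by gcongr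
  linarith

instance (hT : 0 ≤ T) (hγ : 0 ≤ γ) (π : V →L[ℝ] H) : CompleteSpace (solutionSpace hT hγ π) :=
  (Submodule.isClosed_topologicalClosure _).completeSpace_coe

/-- Maximal regularity: `u ↦ (u' + b A u, u(0))` is an isomorphism of `solutionSpace` onto
`L²(0,T;H) × V`. The energy estimate makes it injective with closed range, and the range is
dense. -/
theorem exists_parabolicEquiv (hT : 0 ≤ T) (hγ : 0 ≤ γ) (hb₀ : 0 < b₀) (hM : 0 ≤ M) (hMγ : M ≤ γ)
    (hβ : IsMul b₀ M b β) {π : V →L[ℝ] H} (hπ : ∀ v, ‖π v‖ ≤ ‖v‖)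
    (hinj : ∀ v, π v = 0 → v = 0) (hD : ∀ w, adjoint π w = 0 → w = 0) :
    ∃ e : solutionSpace hT hγ π ≃L[ℝ] Lp H 2 (expMeasure γ T) × V,
      ∀ z, e z = parabolicOp π β z := by
  set P := parabolicOp π β ∘L (solutionSpace hT hγ π).subtypeL with hP
  obtain ⟨C, hC⟩ : ∃ C : NNReal, ∀ z, ‖z‖ ≤ C * ‖P z‖ := by
    refine ⟨NNReal.mk (1 + (1 + 2 * M * (1 + 1 / b₀)) + (1 + 1 / b₀)) (by positivity),
      fun z => ?_⟩
    have h1 := norm_multiplier_le hT hγ hb₀ hMγ hβ z.2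
    have h2 := norm_timeDeriv_le hT hγ hb₀ hM hMγ hβ hπ z.2
    have h3 : ‖z.1.1‖ ≤ ‖parabolicOp π β z‖ := norm_snd_le (parabolicOp π β z)
    have h4 : (0 : ℝ) ≤ ‖parabolicOp π β z‖ := norm_nonneg _
    change max ‖z.1.1‖ (max ‖z.1.2.1‖ ‖z.1.2.2‖) ≤ _ * ‖parabolicOp π β z‖
    have a1 : 0 ≤ (1 + 2 * M * (1 + 1 / b₀)) * ‖parabolicOp π β z‖ := by positivity
    have a2 : 0 ≤ (1 + 1 / b₀) * ‖parabolicOp π β z‖ := by positivity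
    rw [NNReal.coe_mk, add_mul, add_mul, one_mul]
    refine max_le (by linarith) (max_le (by linarith) (by linarith))
  have hanti : AntilipschitzWith C P := P.antilipschitz_of_bound hC
  have hclosed : IsClosed (P.range : Set (Lp H 2 (expMeasure γ T) × V)) :=
    hanti.isClosed_range P.uniformContinuous
  have hmem : ∀ x, parabolicOp π β (trajectory hT hγ π x) ∈ P.range := fun x =>
    ⟨⟨_, trajectory_mem hT hγ π x⟩, rfl⟩
  -- trajectories with `u(0) = 0` give a dense set of right-hand sides
  have hf : ∀ f, ((f, 0) : Lp H 2 (expMeasure γ T) × V) ∈ P.range := by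
    set U := P.range.comap
      (ContinuousLinearMap.inl ℝ (Lp H 2 (expMeasure γ T)) V).toLinearMap with hU
    have hUc : IsClosed (U : Set (Lp H 2 (expMeasure γ T))) :=
      hclosed.preimage (ContinuousLinearMap.inl ℝ (Lp H 2 (expMeasure γ T)) V).continuous
    have hUo : Uᗮ = ⊥ := by
      refine (Submodule.eq_bot_iff _).2 fun g hg => ?_
      refine eq_zero_of_orthogonal hT hγ hb₀ hβ hπ hD g fun k => ?_
      refine (Submodule.mem_orthogonal' _ _).1 hg _ ?_
      have h := hmem (0, k)
      have e : (parabolicOp π β (trajectory hT hγ π (0, k))).2 = 0 := by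
        rw [trajectory_apply, parabolicOp_apply]
        exact map_zero _
      change ((parabolicOp π β (trajectory hT hγ π (0, k))).1, (0 : V)) ∈ P.range
      rwa [← e]
    have hUt : U = ⊤ := by
      rw [← hUc.submodule_topologicalClosure_eq, Submodule.topologicalClosure_eq_top_iff, hUo]
    exact fun f => (hUt ▸ Submodule.mem_top : f ∈ U)
  -- constant `w = w₀` gives the initial values `π† w₀`, which are dense as `π` is injective
  have hv : ∀ v, ((0, v) : Lp H 2 (expMeasure γ T) × V) ∈ P.range := by
    set U := P.range.comap
      (ContinuousLinearMap.inr ℝ (Lp H 2 (expMeasure γ T)) V).toLinearMap with hU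
    have hUc : IsClosed (U : Set V) :=
      hclosed.preimage (ContinuousLinearMap.inr ℝ (Lp H 2 (expMeasure γ T)) V).continuous
    have hUo : Uᗮ = ⊥ := by
      refine (Submodule.eq_bot_iff _).2 fun g hg => hinj g ?_
      refine ext_inner_right ℝ fun w₀ => ?_
      rw [inner_zero_left, ← ContinuousLinearMap.adjoint_inner_right]
      refine (Submodule.mem_orthogonal' _ _).1 hg _ ?_
      have h := P.range.sub_mem (hmem (w₀, 0))
        (hf (parabolicOp π β (trajectory hT hγ π (w₀, 0))).1)
      have e : parabolicOp π β (trajectory hT hγ π (w₀, 0)) -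
          ((parabolicOp π β (trajectory hT hγ π (w₀, 0))).1, 0) = (0, adjoint π w₀) := by
        rw [trajectory_apply, parabolicOp_apply]
        simp
      rw [e] at h
      exact h
    have hUt : U = ⊤ := by
      rw [← hUc.submodule_topologicalClosure_eq, Submodule.topologicalClosure_eq_top_iff, hUo]
    exact fun v => (hUt ▸ Submodule.mem_top : v ∈ U)
  have hrange : P.range = ⊤ := by
    refine Submodule.eq_top_iff'.2 fun y => ?_
    have h := P.range.add_mem (hf y.1) (hv y.2)
    simpa using h
  exact ⟨ContinuousLinearEquiv.ofBijective P (LinearMap.ker_eq_bot.2 hanti.injective) hrange,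
    fun z => rfl⟩

/-- Neumann series for `1 + K` with `‖K‖ ≤ 1/2`. -/
lemma exists_add_apply_eq {Y : Type*} [NormedAddCommGroup Y] [NormedSpace ℝ Y] [CompleteSpace Y]
    (K : Y →L[ℝ] Y) (hK : ∀ y, ‖K y‖ ≤ 1 / 2 * ‖y‖) (y : Y) :
    ∃ z, z + K z = y ∧ ‖z‖ ≤ 2 * ‖y‖ := by
  have h : ‖-K‖ < 1 := by
    rw [norm_neg]
    exact (K.opNorm_le_bound (by norm_num) hK).trans_lt (by norm_num)
  obtain ⟨u, hu⟩ := isUnit_one_sub_of_norm_lt_one h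
  have hz : (u⁻¹.1 y) + K (u⁻¹.1 y) = y := by
    have : (u.1 * u⁻¹.1) y = y := by rw [Units.mul_inv]; rfl
    rw [hu] at this
    simpa using this
  refine ⟨_, hz, ?_⟩
  have h1 : ‖u⁻¹.1 y‖ ≤ ‖y‖ + ‖K (u⁻¹.1 y)‖ := by
    have := norm_sub_le y (K (u⁻¹.1 y))
    rwa [← eq_sub_of_add_eq hz] at this
  have h2 := hK (u⁻¹.1 y)
  linarith

/-- Solvability of the abstract system `uᵢ' + b A uᵢ + Rᵢ(u₁,u₂) = fᵢ`, `uᵢ(0) = π vᵢ`. The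
operators `Rᵢ` are bounded in terms of the form norm, and for `γ` large they are a perturbation of
relative norm at most `1/2`. -/
theorem exists_system_solution (hT : 0 ≤ T) (hγ : 0 ≤ γ) (hb₀ : 0 < b₀) (hM : 0 ≤ M)
    (hβ : IsMul b₀ M b β) {π : V →L[ℝ] H} (hπ : ∀ v, ‖π v‖ ≤ ‖v‖)
    (hinj : ∀ v, π v = 0 → v = 0) (hD : ∀ w, adjoint π w = 0 → w = 0)
    {m : ℝ} (hm : 1 ≤ m) (hMγ : M + (1 / 2 + 1 / (2 * b₀)) * (4 * m) ^ 2 ≤ γ)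
    (R₁ R₂ : Lp V 2 (expMeasure γ T) × Lp V 2 (expMeasure γ T) →L[ℝ] Lp H 2 (expMeasure γ T))
    (hR₁ : ∀ p, ‖R₁ p‖ ≤ m * (‖p.1‖ + ‖p.2‖)) (hR₂ : ∀ p, ‖R₂ p‖ ≤ m * (‖p.1‖ + ‖p.2‖))
    (f₁ f₂ : Lp H 2 (expMeasure γ T)) (v₁ v₂ : V) :
    ∃ z₁ ∈ solutionSpace hT hγ π, ∃ z₂ ∈ solutionSpace hT hγ π,
      z₁.1 = v₁ ∧ z₂.1 = v₂ ∧
      (parabolicOp π β z₁).1 + R₁ ((adjoint π).compLpL 2 (expMeasure γ T) z₁.2.2,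
        (adjoint π).compLpL 2 (expMeasure γ T) z₂.2.2) = f₁ ∧
      (parabolicOp π β z₂).1 + R₂ ((adjoint π).compLpL 2 (expMeasure γ T) z₁.2.2,
        (adjoint π).compLpL 2 (expMeasure γ T) z₂.2.2) = f₂ ∧
      ‖parabolicOp π β z₁‖ ≤ 2 * (‖f₁‖ + ‖f₂‖ + ‖v₁‖ + ‖v₂‖) ∧
      ‖parabolicOp π β z₂‖ ≤ 2 * (‖f₁‖ + ‖f₂‖ + ‖v₁‖ + ‖v₂‖) := by
  have hMγ' : M ≤ γ := by
    have : 0 ≤ (1 / 2 + 1 / (2 * b₀)) * (4 * m) ^ 2 := by positivity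
    linarith
  obtain ⟨e, he⟩ := exists_parabolicEquiv hT hγ hb₀ hM hMγ' hβ hπ hinj hD
  set Q : Lp H 2 (expMeasure γ T) × V →L[ℝ] Lp V 2 (expMeasure γ T) :=
    (adjoint π).compLpL 2 (expMeasure γ T) ∘L ContinuousLinearMap.snd ℝ _ _ ∘L
      ContinuousLinearMap.snd ℝ _ _ ∘L (solutionSpace hT hγ π).subtypeL ∘L
      (e.symm : Lp H 2 (expMeasure γ T) × V →L[ℝ] solutionSpace hT hγ π) with hQdef
  have hQ : ∀ y, 4 * m * ‖Q y‖ ≤ ‖y‖ := fun y => by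
    have h := norm_formPart_le hT hγ hb₀ hβ hMγ (e.symm y).2
    rw [← he, e.apply_symm_apply] at h
    exact h
  -- the lower-order terms as functions of the data `(f, v)` of the principal part
  set K := ((R₁ ∘L Q.prodMap Q).prod (0 : _ →L[ℝ] V)).prod
    ((R₂ ∘L Q.prodMap Q).prod (0 : _ →L[ℝ] V)) with hKdef
  have hK : ∀ y, ‖K y‖ ≤ 1 / 2 * ‖y‖ := fun y => by
    have h1 := hQ y.1
    have h2 := hQ y.2
    have h3 := norm_fst_le y
    have h4 := norm_snd_le y
    have h5 := hR₁ (Q y.1, Q y.2)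
    have h6 := hR₂ (Q y.1, Q y.2)
    have h7 : (0 : ℝ) ≤ 1 / 2 * ‖y‖ := by positivity
    change max (max ‖R₁ (Q y.1, Q y.2)‖ ‖(0 : V)‖) (max ‖R₂ (Q y.1, Q y.2)‖ ‖(0 : V)‖) ≤ _
    rw [norm_zero]
    dsimp only at h5 h6
    refine max_le (max_le (by linarith) h7) (max_le (by linarith) h7)
  obtain ⟨y, hy, hyn⟩ := exists_add_apply_eq K hK ((f₁, v₁), (f₂, v₂))
  have hn : ‖(((f₁, v₁), (f₂, v₂)) :
      (Lp H 2 (expMeasure γ T) × V) × (Lp H 2 (expMeasure γ T) × V))‖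
      ≤ ‖f₁‖ + ‖f₂‖ + ‖v₁‖ + ‖v₂‖ := by
    have := norm_nonneg f₁
    have := norm_nonneg f₂
    have := norm_nonneg v₁
    have := norm_nonneg v₂
    exact max_le (max_le (by linarith) (by linarith)) (max_le (by linarith) (by linarith))
  have e1 : parabolicOp π β (e.symm y.1) = y.1 := by rw [← he, e.apply_symm_apply]
  have e2 : parabolicOp π β (e.symm y.2) = y.2 := by rw [← he, e.apply_symm_apply]
  refine ⟨_, (e.symm y.1).2, _, (e.symm y.2).2, ?_, ?_, ?_, ?_, ?_, ?_⟩
  · have h := congrArg Prod.snd e1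
    have h' := congrArg (fun q => q.1.2) hy
    simp only [hKdef, ContinuousLinearMap.prod_apply, Prod.fst_add, Prod.snd_add] at h'
    change (e.symm y.1).1.1 = _ at h
    rw [h]
    simpa using h'
  · have h := congrArg Prod.snd e2
    have h' := congrArg (fun q => q.2.2) hy
    simp only [hKdef, ContinuousLinearMap.prod_apply, Prod.snd_add] at h'
    change (e.symm y.2).1.1 = _ at h
    rw [h]
    simpa using h'
  · rw [e1]
    exact congrArg (fun q => q.1.1) hy
  · rw [e2]
    exact congrArg (fun q => q.2.1) hy
  · rw [e1]
    exact (norm_fst_le y).trans (hyn.trans (by linarith))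
  · rw [e2]
    exact (norm_snd_le y).trans (hyn.trans (by linarith))

end AbstractSolvability

/-! ### Absolutely continuous functions on the unit interval -/

lemma integral_μΩ (g : ℝ → ℝ) : ∫ x, g x ∂μΩ = ∫ x in (0 : ℝ)..1, g x := by
  rw [intervalIntegral.integral_of_le zero_le_one, integral_Ioc_eq_integral_Ioo]

lemma inner_L2Ω (f g : L2Ω) : ⟪f, g⟫ = ∫ x in (0 : ℝ)..1, f x * g x := by
  rw [L2.inner_def, ← integral_μΩ]
  refine integral_congr_ae (Filter.Eventually.of_forall fun x => ?_)
  simp [mul_comm]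

lemma ae_mem_unitInterval : ∀ᵐ x ∂μΩ, x ∈ Ioo (0 : ℝ) 1 := ae_restrict_mem measurableSet_Ioo

lemma intervalIntegrable_of_integrable {g : ℝ → ℝ} (hg : Integrable g μΩ) {x y : ℝ}
    (hx : x ∈ Icc (0 : ℝ) 1) (hy : y ∈ Icc (0 : ℝ) 1) : IntervalIntegrable g volume x y := by
  have h : IntervalIntegrable g volume 0 1 := by
    rw [intervalIntegrable_iff_integrableOn_Ioo_of_le zero_le_one]
    exact hg
  refine h.mono_set ?_
  rw [uIcc_of_le zero_le_one]
  exact uIcc_subset_Icc hx hy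

lemma integral_congr_μΩ {f g : ℝ → ℝ} (h : f =ᵐ[μΩ] g) {x : ℝ} (hx : x ∈ Icc (0 : ℝ) 1) :
    ∫ s in (0 : ℝ)..x, f s = ∫ s in (0 : ℝ)..x, g s := by
  rw [intervalIntegral.integral_of_le hx.1, intervalIntegral.integral_of_le hx.1,
    integral_Ioc_eq_integral_Ioo, integral_Ioc_eq_integral_Ioo]
  exact integral_congr_ae (ae_restrict_of_ae_restrict_of_subset (Ioo_subset_Ioo_right hx.2) h)

lemma absolutelyContinuous_primitive {g : ℝ → ℝ} (hg : Integrable g μΩ) :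
    AbsolutelyContinuousOnInterval (fun x => ∫ s in (0 : ℝ)..x, g s) 0 1 :=
  (intervalIntegrable_of_integrable hg (left_mem_Icc.2 zero_le_one)
    (right_mem_Icc.2 zero_le_one)).absolutelyContinuousOnInterval_intervalIntegral left_mem_uIcc

lemma deriv_primitive_ae {g : ℝ → ℝ} (hg : Integrable g μΩ) :
    deriv (fun x => ∫ s in (0 : ℝ)..x, g s) =ᵐ[μΩ] g := by
  have h := (intervalIntegrable_of_integrable hg (left_mem_Icc.2 zero_le_one)
    (right_mem_Icc.2 zero_le_one)).ae_hasDerivAt_integral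
  filter_upwards [ae_restrict_of_ae h, ae_mem_unitInterval] with x hx hx'
  refine (hx ?_ 0 left_mem_uIcc).deriv
  rw [uIcc_of_le zero_le_one]
  exact Ioo_subset_Icc_self hx'

lemma eq_integral_deriv {F : ℝ → ℝ} (hF : AbsolutelyContinuousOnInterval F 0 1) {x : ℝ}
    (hx : x ∈ Icc (0 : ℝ) 1) : F x = F 0 + ∫ s in (0 : ℝ)..x, deriv F s := by
  have h : AbsolutelyContinuousOnInterval F 0 x := by
    refine hF.mono ?_
    rw [uIcc_of_le zero_le_one]
    exact uIcc_subset_Icc (left_mem_Icc.2 zero_le_one) hx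
  rw [h.integral_deriv_eq_sub]
  ring

lemma ae_differentiableAt_μΩ {F : ℝ → ℝ} (hF : AbsolutelyContinuousOnInterval F 0 1) :
    ∀ᵐ x ∂μΩ, DifferentiableAt ℝ F x := by
  filter_upwards [ae_restrict_of_ae hF.ae_differentiableAt, ae_mem_unitInterval] with x hx hx'
  refine hx ?_
  rw [uIcc_of_le zero_le_one]
  exact Ioo_subset_Icc_self hx'

lemma eqOn_of_ae_eq_μΩ {F G : ℝ → ℝ} (hF : AbsolutelyContinuousOnInterval F 0 1)
    (hG : AbsolutelyContinuousOnInterval G 0 1) (h : F =ᵐ[μΩ] G) : EqOn F G (Ioo 0 1) := by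
  have hF' := hF.continuousOn
  have hG' := hG.continuousOn
  rw [uIcc_of_le zero_le_one] at hF' hG'
  exact Measure.eqOn_Ioo_of_ae_eq volume h (hF'.mono Ioo_subset_Icc_self)
    (hG'.mono Ioo_subset_Icc_self)

lemma deriv_eqOn {F G : ℝ → ℝ} (h : EqOn F G (Ioo 0 1)) :
    EqOn (deriv F) (deriv G) (Ioo 0 1) := fun _ hx =>
  (h.eventuallyEq_of_mem (isOpen_Ioo.mem_nhds hx)).deriv_eq

lemma IsRep.eqOn_deriv {f : L2Ω} {F G : ℝ → ℝ} (hF : IsRep f F) (hG : IsRep f G) :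
    EqOn (deriv F) (deriv G) (Ioo 0 1) :=
  deriv_eqOn (eqOn_of_ae_eq_μΩ hF.1 hG.1 (hF.2.2.2.symm.trans hG.2.2.2))

/-! ### Uniqueness and linearity of the weighted derivatives -/

variable {a : ℝ → ℝ}

lemma HasSqrtADx.unique {f p p' : L2Ω} (h : HasSqrtADx a f p) (h' : HasSqrtADx a f p') :
    p = p' := by
  obtain ⟨F, hF, hp⟩ := h
  obtain ⟨G, hG, hp'⟩ := h'
  ext1
  filter_upwards [hp, hp', ae_mem_unitInterval] with x h1 h2 hx
  rw [h1, h2, hF.eqOn_deriv hG hx]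

lemma HasDivADx.unique {f q q' : L2Ω} (h : HasDivADx a f q) (h' : HasDivADx a f q') :
    q = q' := by
  obtain ⟨-, F, W, hF, hW, hWF, hq⟩ := h
  obtain ⟨-, G, Z, hG, hZ, hZG, hq'⟩ := h'
  have hWZ : W =ᵐ[μΩ] Z := by
    filter_upwards [hWF, hZG, ae_mem_unitInterval] with x h1 h2 hx
    rw [h1, h2, hF.eqOn_deriv hG hx]
  ext1
  filter_upwards [hq, hq', ae_mem_unitInterval] with x h1 h2 hx
  rw [h1, h2, deriv_eqOn (eqOn_of_ae_eq_μΩ hW hZ hWZ) hx]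

lemma HasSqrtADx.sqrtADx_eq {f p : L2Ω} (h : HasSqrtADx a f p) : sqrtADx a f = p := by
  have hf : MemH1a a f := ⟨p, h⟩
  rw [sqrtADx, dif_pos hf]
  exact hf.choose_spec.unique h

lemma HasDivADx.divADx_eq {f q : L2Ω} (h : HasDivADx a f q) : divADx a f = q := by
  have hf : MemH2a a f := ⟨q, h⟩
  rw [divADx, dif_pos hf]
  exact hf.choose_spec.unique h

lemma MemH1a.hasSqrtADx {f : L2Ω} (h : MemH1a a f) : HasSqrtADx a f (sqrtADx a f) := by
  obtain ⟨p, hp⟩ := h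
  rwa [hp.sqrtADx_eq]

lemma MemH2a.hasDivADx {f : L2Ω} (h : MemH2a a f) : HasDivADx a f (divADx a f) := by
  obtain ⟨q, hq⟩ := h
  rwa [hq.divADx_eq]

lemma MemH2a.memH1a {f : L2Ω} (h : MemH2a a f) : MemH1a a f := h.hasDivADx.1

lemma HasSqrtADx.zero : HasSqrtADx a 0 0 := by
  refine ⟨0, ⟨?_, rfl, rfl, Lp.coeFn_zero _ _ _⟩, ?_⟩
  · exact (LipschitzWith.const (0 : ℝ)).lipschitzOnWith.absolutelyContinuousOnInterval
  · filter_upwards [Lp.coeFn_zero ℝ 2 μΩ] with x hx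
    rw [hx]
    simp

lemma HasSqrtADx.add {f g p r : L2Ω} (hf : HasSqrtADx a f p) (hg : HasSqrtADx a g r) :
    HasSqrtADx a (f + g) (p + r) := by
  obtain ⟨F, ⟨hF, hF0, hF1, hFf⟩, hp⟩ := hf
  obtain ⟨G, ⟨hG, hG0, hG1, hGg⟩, hr⟩ := hg
  refine ⟨F + G, ⟨hF.add hG, by simp [hF0, hG0], by simp [hF1, hG1], ?_⟩, ?_⟩
  · exact (Lp.coeFn_add f g).trans (hFf.add hGg)
  · filter_upwards [Lp.coeFn_add p r, hp, hr, ae_differentiableAt_μΩ hF,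
      ae_differentiableAt_μΩ hG] with x h1 h2 h3 h4 h5
    rw [h1, Pi.add_apply, h2, h3, deriv_add h4 h5]
    ring

lemma HasSqrtADx.smul {f p : L2Ω} (c : ℝ) (hf : HasSqrtADx a f p) :
    HasSqrtADx a (c • f) (c • p) := by
  obtain ⟨F, ⟨hF, hF0, hF1, hFf⟩, hp⟩ := hf
  refine ⟨fun x => c * F x, ⟨hF.const_mul c, by simp [hF0], by simp [hF1], ?_⟩, ?_⟩
  · filter_upwards [Lp.coeFn_smul c f, hFf] with x h1 h2
    rw [h1, Pi.smul_apply, h2, smul_eq_mul]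
  · filter_upwards [Lp.coeFn_smul c p, hp] with x h1 h2
    rw [h1, Pi.smul_apply, h2, deriv_const_mul_field, smul_eq_mul]
    ring

lemma HasSqrtADx.sub {f g p r : L2Ω} (hf : HasSqrtADx a f p) (hg : HasSqrtADx a g r) :
    HasSqrtADx a (f - g) (p - r) := by
  have := hf.add (hg.smul (-1))
  simpa [sub_eq_add_neg] using this

/-- Integration by parts: `∫ (a f_x)_x φ = -∫ a f_x φ_x`. -/
lemma HasDivADx.inner_eq (ha : ∀ x ∈ Ioc (0 : ℝ) 1, 0 < a x) {f p q φ ψ : L2Ω}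
    (hq : HasDivADx a f q) (hp : HasSqrtADx a f p) (hφ : HasSqrtADx a φ ψ) :
    ⟪q, φ⟫ = -⟪p, ψ⟫ := by
  obtain ⟨-, F, W, hF, hW, hWF, hqW⟩ := hq
  obtain ⟨G, hG, hpG⟩ := hp
  obtain ⟨Φ, hΦ, hψΦ⟩ := hφ
  have h1 : ⟪q, φ⟫ = ∫ x in (0 : ℝ)..1, deriv W x * Φ x := by
    rw [inner_L2Ω]
    refine integral_congr_μΩ ?_ (right_mem_Icc.2 zero_le_one)
    filter_upwards [hqW, hΦ.2.2.2] with x h1 h2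
    rw [h1, h2]
  have h2 : ⟪p, ψ⟫ = ∫ x in (0 : ℝ)..1, W x * deriv Φ x := by
    rw [inner_L2Ω]
    refine integral_congr_μΩ ?_ (right_mem_Icc.2 zero_le_one)
    filter_upwards [hpG, hψΦ, hWF, ae_mem_unitInterval] with x h1 h2 h3 hx
    rw [h1, h2, h3, hF.eqOn_deriv hG hx]
    have := Real.mul_self_sqrt (ha x (Ioo_subset_Ioc_self hx)).le
    linear_combination (deriv G x * deriv Φ x) * this
  have h3 := hW.integral_mul_deriv_eq_deriv_mul hΦ.1
  rw [hΦ.2.1, hΦ.2.2.1] at h3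
  rw [h1, h2, h3]
  ring

/-! ### The weight `1/√a` and the representation of `H¹ₐ(0,1)` -/

namespace WeaklyDegenerate

/-- `x a' ≤ K a` says that `x^{-K} a(x)` is nonincreasing. -/
lemma le_apply (ha : WeaklyDegenerate a) :
    ∃ K : ℝ, K < 1 ∧ ∀ x ∈ Ioc (0 : ℝ) 1, a 1 * x ^ K ≤ a x := by
  obtain ⟨K, -, hK1, hK⟩ := ha.exists_K
  refine ⟨K, hK1, ?_⟩
  have hd : ∀ x ∈ Ioo (0 : ℝ) 1, HasDerivAt (fun x => a x * x ^ (-K))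
      (derivWithin a (Ioc 0 1) x * x ^ (-K) + a x * (-K * x ^ (-K - 1))) x := fun x hx => by
    have h1 : HasDerivAt a (derivWithin a (Ioc 0 1) x) x :=
      ((ha.contDiffOn.differentiableOn (by norm_num)) x
        (Ioo_subset_Ioc_self hx)).hasDerivWithinAt.hasDerivAt
        (Filter.mem_of_superset (isOpen_Ioo.mem_nhds hx) Ioo_subset_Ioc_self)
    exact h1.mul (Real.hasDerivAt_rpow_const (Or.inl hx.1.ne'))
  have hanti : AntitoneOn (fun x => a x * x ^ (-K)) (Ioc 0 1) := by
    refine antitoneOn_of_deriv_nonpos (convex_Ioc 0 1) ?_ ?_ ?_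
    · refine (ha.continuousOn.mono Ioc_subset_Icc_self).mul fun x hx => ?_
      exact (Real.continuousAt_rpow_const _ _ (Or.inl hx.1.ne')).continuousWithinAt
    · rw [interior_Ioc]
      exact fun x hx => (hd x hx).differentiableAt.differentiableWithinAt
    · rw [interior_Ioc]
      intro x hx
      rw [(hd x hx).deriv]
      have e : x ^ (-K) = x * x ^ (-K - 1) := by
        rw [Real.rpow_sub_one hx.1.ne', mul_div_cancel₀ _ hx.1.ne']
      have e2 : 0 ≤ x ^ (-K - 1) := Real.rpow_nonneg hx.1.le _
      have := hK x (Ioo_subset_Ioc_self hx)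
      rw [e]
      nlinarith
  intro x hx
  have h := hanti hx (right_mem_Ioc.2 zero_lt_one) hx.2
  simp only [Real.one_rpow, mul_one] at h
  calc a 1 * x ^ K ≤ a x * x ^ (-K) * x ^ K :=
        mul_le_mul_of_nonneg_right h (Real.rpow_nonneg hx.1.le _)
    _ = a x := by
        rw [mul_assoc, ← Real.rpow_add hx.1]
        simp

lemma continuousOn_inv_sqrt (ha : WeaklyDegenerate a) :
    ContinuousOn (fun x => (√(a x))⁻¹) (Ioo 0 1) := by
  refine ContinuousOn.inv₀ ((ha.continuousOn.mono Ioo_subset_Icc_self).sqrt) fun x hx => ?_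
  exact (Real.sqrt_pos.2 (ha.pos x (Ioo_subset_Ioc_self hx))).ne'

/-- Weak degeneracy in the form in which it is used: `1/a ∈ L¹(0,1)`. -/
lemma memLp_inv_sqrt (ha : WeaklyDegenerate a) : MemLp (fun x => (√(a x))⁻¹) 2 μΩ := by
  have hm : AEStronglyMeasurable (fun x => (√(a x))⁻¹) μΩ :=
    ha.continuousOn_inv_sqrt.aestronglyMeasurable measurableSet_Ioo
  rw [memLp_two_iff_integrable_sq hm]
  obtain ⟨K, hK1, hK⟩ := ha.le_apply
  have ha1 := ha.pos 1 (right_mem_Ioc.2 zero_lt_one)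
  have hi : Integrable (fun x : ℝ => (a 1)⁻¹ * x ^ (-K)) μΩ := by
    refine Integrable.const_mul ?_ _
    have h := intervalIntegral.intervalIntegrable_rpow' (a := 0) (b := 1) (r := -K) (by linarith)
    rwa [intervalIntegrable_iff_integrableOn_Ioo_of_le zero_le_one] at h
  refine hi.mono' (hm.pow 2) ?_
  filter_upwards [ae_mem_unitInterval] with x hx
  have hx' := Ioo_subset_Ioc_self hx
  rw [inv_pow, Real.sq_sqrt (ha.pos x hx').le, Real.norm_of_nonneg (inv_nonneg.2 (ha.pos x hx').le),
    Real.rpow_neg hx.1.le, ← mul_inv]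
  exact inv_anti₀ (mul_pos ha1 (Real.rpow_pos_of_pos hx.1 _)) (hK x hx')

/-- The function `1/√a` as an element of `L²(0,1)`. -/
def invSqrt (ha : WeaklyDegenerate a) : L2Ω := ha.memLp_inv_sqrt.toLp _

lemma coeFn_invSqrt (ha : WeaklyDegenerate a) : ha.invSqrt =ᵐ[μΩ] fun x => (√(a x))⁻¹ :=
  ha.memLp_inv_sqrt.coeFn_toLp

lemma integrable_mul (f g : L2Ω) : Integrable (fun x => f x * g x) μΩ :=
  (Lp.memLp f).integrable_mul (Lp.memLp g)

/-- The primitive `x ↦ ∫₀ˣ p/√a`. -/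
def weightedPrimitive (ha : WeaklyDegenerate a) (p : L2Ω) (x : ℝ) : ℝ :=
  ∫ s in (0 : ℝ)..x, ha.invSqrt s * p s

lemma absolutelyContinuous_weightedPrimitive (ha : WeaklyDegenerate a) (p : L2Ω) :
    AbsolutelyContinuousOnInterval (ha.weightedPrimitive p) 0 1 :=
  absolutelyContinuous_primitive (integrable_mul _ _)

lemma weightedPrimitive_one (ha : WeaklyDegenerate a) (p : L2Ω) :
    ha.weightedPrimitive p 1 = ⟪ha.invSqrt, p⟫ := (inner_L2Ω _ _).symm

lemma deriv_weightedPrimitive (ha : WeaklyDegenerate a) (p : L2Ω) :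
    deriv (ha.weightedPrimitive p) =ᵐ[μΩ] fun x => (√(a x))⁻¹ * p x := by
  filter_upwards [deriv_primitive_ae (integrable_mul ha.invSqrt p), ha.coeFn_invSqrt] with x h1 h2
  change deriv (fun x => ∫ s in (0 : ℝ)..x, ha.invSqrt s * p s) x = _
  rw [h1, h2]

lemma abs_weightedPrimitive_le (ha : WeaklyDegenerate a) (p : L2Ω) {x : ℝ}
    (hx : x ∈ Icc (0 : ℝ) 1) : |ha.weightedPrimitive p x| ≤ ‖ha.invSqrt‖ * ‖p‖ := by
  have hi := integrable_mul ha.invSqrt p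
  calc |ha.weightedPrimitive p x| ≤ ∫ s in (0 : ℝ)..x, |ha.invSqrt s * p s| :=
        intervalIntegral.abs_integral_le_integral_abs hx.1
    _ ≤ ∫ s, |ha.invSqrt s * p s| ∂μΩ := by
        rw [intervalIntegral.integral_of_le hx.1, integral_Ioc_eq_integral_Ioo]
        exact setIntegral_mono_set hi.abs (Filter.Eventually.of_forall fun _ => abs_nonneg _)
          (Ioo_subset_Ioo_right hx.2).eventuallyLE
    _ = ⟪|ha.invSqrt|, |p|⟫ := by
        rw [inner_L2Ω, integral_μΩ]
        refine integral_congr_μΩ ?_ (right_mem_Icc.2 zero_le_one)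
        filter_upwards [Lp.coeFn_abs ha.invSqrt, Lp.coeFn_abs p] with s h1 h2
        rw [h1, h2, abs_mul]
    _ ≤ ‖ha.invSqrt‖ * ‖p‖ := by
        have := real_inner_le_norm |ha.invSqrt| |p|
        rwa [norm_abs_eq_norm, norm_abs_eq_norm] at this

lemma weightedPrimitive_add (ha : WeaklyDegenerate a) (p r : L2Ω) {x : ℝ}
    (hx : x ∈ Icc (0 : ℝ) 1) : ha.weightedPrimitive (p + r) x
      = ha.weightedPrimitive p x + ha.weightedPrimitive r x := by
  have h0 : (0 : ℝ) ∈ Icc (0 : ℝ) 1 := left_mem_Icc.2 zero_le_one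
  rw [weightedPrimitive, weightedPrimitive, weightedPrimitive, ← intervalIntegral.integral_add
    (intervalIntegrable_of_integrable (integrable_mul _ _) h0 hx)
    (intervalIntegrable_of_integrable (integrable_mul _ _) h0 hx)]
  refine integral_congr_μΩ ?_ hx
  filter_upwards [Lp.coeFn_add p r] with s h
  rw [h, Pi.add_apply]
  ring

lemma weightedPrimitive_smul (ha : WeaklyDegenerate a) (c : ℝ) (p : L2Ω) {x : ℝ}
    (hx : x ∈ Icc (0 : ℝ) 1) : ha.weightedPrimitive (c • p) x = c * ha.weightedPrimitive p x := by
  rw [weightedPrimitive, weightedPrimitive, ← intervalIntegral.integral_const_mul]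
  refine integral_congr_μΩ ?_ hx
  filter_upwards [Lp.coeFn_smul c p] with s h
  rw [h, Pi.smul_apply, smul_eq_mul]
  ring

lemma memLp_weightedPrimitive (ha : WeaklyDegenerate a) (p : L2Ω) :
    MemLp (ha.weightedPrimitive p) 2 μΩ := by
  refine MemLp.of_bound ?_ (‖ha.invSqrt‖ * ‖p‖) ?_
  · have h := (ha.absolutelyContinuous_weightedPrimitive p).continuousOn
    rw [uIcc_of_le zero_le_one] at h
    exact (h.mono Ioo_subset_Icc_self).aestronglyMeasurable measurableSet_Ioo
  · filter_upwards [ae_mem_unitInterval] with x hx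
    exact ha.abs_weightedPrimitive_le p (Ioo_subset_Icc_self hx)

/-- The bounded operator `p ↦ ∫₀ˣ p/√a` on `L²(0,1)`. -/
def primitiveL (ha : WeaklyDegenerate a) : L2Ω →L[ℝ] L2Ω :=
  LinearMap.mkContinuous
    { toFun := fun p => (ha.memLp_weightedPrimitive p).toLp _
      map_add' := fun p r => by
        rw [← MemLp.toLp_add]
        refine MemLp.toLp_congr _ _ ?_
        filter_upwards [ae_mem_unitInterval] with x hx
        exact ha.weightedPrimitive_add p r (Ioo_subset_Icc_self hx)
      map_smul' := fun c p => by
        rw [RingHom.id_apply, ← MemLp.toLp_const_smul]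
        refine MemLp.toLp_congr _ _ ?_
        filter_upwards [ae_mem_unitInterval] with x hx
        exact ha.weightedPrimitive_smul c p (Ioo_subset_Icc_self hx) }
    (↑(measureUnivNNReal μΩ) ^ (2 : ℝ≥0∞).toReal⁻¹ * ‖ha.invSqrt‖) fun p => by
      rw [mul_assoc]
      refine Lp.norm_le_of_ae_bound (by positivity) ?_
      filter_upwards [ae_mem_unitInterval, (ha.memLp_weightedPrimitive p).coeFn_toLp] with x hx h
      simp only [LinearMap.coe_mk, AddHom.coe_mk]
      rw [h]
      exact ha.abs_weightedPrimitive_le p (Ioo_subset_Icc_self hx)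

lemma coeFn_primitiveL (ha : WeaklyDegenerate a) (p : L2Ω) :
    ha.primitiveL p =ᵐ[μΩ] ha.weightedPrimitive p :=
  (ha.memLp_weightedPrimitive p).coeFn_toLp

/-- A function of `H¹ₐ(0,1)` is the primitive of `p/√a`, where `p = √a f_x` is orthogonal to
`1/√a` because of the boundary condition at `1`. -/
lemma hasSqrtADx_iff (ha : WeaklyDegenerate a) {f p : L2Ω} :
    HasSqrtADx a f p ↔ f = ha.primitiveL p ∧ ⟪ha.invSqrt, p⟫ = 0 := by
  constructor
  · rintro ⟨F, ⟨hF, hF0, hF1, hFf⟩, hp⟩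
    have hd : deriv F =ᵐ[μΩ] fun x => ha.invSqrt x * p x := by
      filter_upwards [hp, ha.coeFn_invSqrt, ae_mem_unitInterval] with x h1 h2 hx
      have := (Real.sqrt_pos.2 (ha.pos x (Ioo_subset_Ioc_self hx))).ne'
      rw [h1, h2]
      field_simp
    have hx : ∀ x ∈ Icc (0 : ℝ) 1, F x = ha.weightedPrimitive p x := fun x hx => by
      rw [eq_integral_deriv hF hx, hF0, zero_add, integral_congr_μΩ hd hx, weightedPrimitive]
    refine ⟨?_, ?_⟩
    · ext1
      filter_upwards [hFf, ha.coeFn_primitiveL p, ae_mem_unitInterval] with x h1 h2 h3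
      rw [h1, h2, hx x (Ioo_subset_Icc_self h3)]
    · rw [← weightedPrimitive_one, ← hx 1 (right_mem_Icc.2 zero_le_one), hF1]
  · rintro ⟨rfl, hp⟩
    refine ⟨ha.weightedPrimitive p, ⟨ha.absolutelyContinuous_weightedPrimitive p, ?_, ?_,
      ha.coeFn_primitiveL p⟩, ?_⟩
    · rw [weightedPrimitive, intervalIntegral.integral_same]
    · rw [weightedPrimitive_one, hp]
    · filter_upwards [ha.deriv_weightedPrimitive p, ae_mem_unitInterval] with x h1 hx
      have := (Real.sqrt_pos.2 (ha.pos x (Ioo_subset_Ioc_self hx))).ne'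
      rw [h1]
      field_simp

end WeaklyDegenerate

/-! ### The form domain and the degenerate operator -/

/-- The Hilbert space `H¹ₐ(0,1)`, realised as the set of pairs `(f, √a f_x)` in `L²(0,1)²` with
the Euclidean product norm, which is then the norm of `H¹ₐ(0,1)`. -/
def formSpace (_ha : WeaklyDegenerate a) : Submodule ℝ (WithLp 2 (L2Ω × L2Ω)) where
  carrier := {z | HasSqrtADx a z.fst z.snd}
  add_mem' := fun h h' => HasSqrtADx.add h h'
  zero_mem' := HasSqrtADx.zero
  smul_mem' := fun c _ h => HasSqrtADx.smul c h

namespace WeaklyDegenerate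

lemma isClosed_formSpace (ha : WeaklyDegenerate a) :
    IsClosed (formSpace ha : Set (WithLp 2 (L2Ω × L2Ω))) := by
  have e : (formSpace ha : Set (WithLp 2 (L2Ω × L2Ω))) =
      {z | z.fst = ha.primitiveL z.snd} ∩ {z | ⟪ha.invSqrt, z.snd⟫ = 0} := by
    ext z
    exact ha.hasSqrtADx_iff
  have c1 : Continuous fun z : WithLp 2 (L2Ω × L2Ω) => z.fst := WithLp.continuous_fst ..
  have c2 : Continuous fun z : WithLp 2 (L2Ω × L2Ω) => z.snd := WithLp.continuous_snd ..
  rw [e]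
  exact (isClosed_eq c1 (ha.primitiveL.continuous.comp c2)).inter
    (isClosed_eq (by fun_prop) continuous_const)

instance (ha : WeaklyDegenerate a) : CompleteSpace (formSpace ha) :=
  ha.isClosed_formSpace.completeSpace_coe

/-- The inclusion of `H¹ₐ(0,1)` into `L²(0,1)`. -/
def embedding (ha : WeaklyDegenerate a) : formSpace ha →L[ℝ] L2Ω :=
  WithLp.fstL 2 ℝ L2Ω L2Ω ∘L (formSpace ha).subtypeL

/-- The map `f ↦ √a f_x` from `H¹ₐ(0,1)` to `L²(0,1)`. -/
def weightedDeriv (ha : WeaklyDegenerate a) : formSpace ha →L[ℝ] L2Ω :=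
  WithLp.sndL 2 ℝ L2Ω L2Ω ∘L (formSpace ha).subtypeL

lemma hasSqrtADx_embedding (ha : WeaklyDegenerate a) (v : formSpace ha) :
    HasSqrtADx a (ha.embedding v) (ha.weightedDeriv v) := v.2

lemma norm_sq_eq (ha : WeaklyDegenerate a) (v : formSpace ha) :
    ‖v‖ ^ 2 = ‖ha.embedding v‖ ^ 2 + ‖ha.weightedDeriv v‖ ^ 2 :=
  WithLp.prod_norm_sq_eq_of_L2 v.1

lemma norm_embedding_le (ha : WeaklyDegenerate a) (v : formSpace ha) :
    ‖ha.embedding v‖ ≤ ‖v‖ := by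
  refine abs_le_of_sq_le_sq' ?_ (norm_nonneg _) |>.2
  rw [ha.norm_sq_eq]
  nlinarith [sq_nonneg ‖ha.weightedDeriv v‖]

lemma norm_weightedDeriv_le (ha : WeaklyDegenerate a) (v : formSpace ha) :
    ‖ha.weightedDeriv v‖ ≤ ‖v‖ := by
  refine abs_le_of_sq_le_sq' ?_ (norm_nonneg _) |>.2
  rw [ha.norm_sq_eq]
  nlinarith [sq_nonneg ‖ha.embedding v‖]

lemma inner_formSpace (ha : WeaklyDegenerate a) (v v' : formSpace ha) :
    ⟪v, v'⟫ = ⟪ha.embedding v, ha.embedding v'⟫ + ⟪ha.weightedDeriv v, ha.weightedDeriv v'⟫ := rfl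

/-- The element of `H¹ₐ(0,1)` given by `f` and `p = √a f_x`. -/
def toForm (ha : WeaklyDegenerate a) {f p : L2Ω} (h : HasSqrtADx a f p) : formSpace ha :=
  ⟨WithLp.toLp 2 (f, p), h⟩

lemma embedding_toForm (ha : WeaklyDegenerate a) {f p : L2Ω} (h : HasSqrtADx a f p) :
    ha.embedding (ha.toForm h) = f := rfl

lemma weightedDeriv_toForm (ha : WeaklyDegenerate a) {f p : L2Ω} (h : HasSqrtADx a f p) :
    ha.weightedDeriv (ha.toForm h) = p := rfl

lemma norm_toForm (ha : WeaklyDegenerate a) {f : L2Ω} (h : MemH1a a f) :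
    ‖ha.toForm h.hasSqrtADx‖ = normH1a a f := by
  rw [normH1a, ← Real.sqrt_sq (norm_nonneg (ha.toForm h.hasSqrtADx)), ha.norm_sq_eq]
  rfl

lemma embedding_injective (ha : WeaklyDegenerate a) (v : formSpace ha)
    (hv : ha.embedding v = 0) : v = 0 := by
  have h := ha.hasSqrtADx_embedding v
  rw [hv] at h
  have h2 : ha.weightedDeriv v = 0 := h.unique HasSqrtADx.zero
  rw [← norm_eq_zero, ← sq_eq_zero_iff, ha.norm_sq_eq, hv, h2]
  simp

/-- The weak form of `f + A f = w`, where `A f = -(a f_x)_x`. -/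
lemma inner_adjoint_embedding (ha : WeaklyDegenerate a) (w : L2Ω) {φ ψ : L2Ω}
    (h : HasSqrtADx a φ ψ) :
    ⟪ha.embedding (adjoint ha.embedding w), φ⟫ + ⟪ha.weightedDeriv (adjoint ha.embedding w), ψ⟫
      = ⟪w, φ⟫ := by
  have e := ContinuousLinearMap.adjoint_inner_left ha.embedding (ha.toForm h) w
  rwa [inner_formSpace, embedding_toForm, weightedDeriv_toForm] at e

/-- Elliptic regularity: the weak solution `f` of `f + A f = w` belongs to `H²ₐ(0,1)`, and
`(a f_x)_x = f - w`. By duality against all `ψ ⟂ 1/√a`, the flux `a f_x` differs from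
`-∫₀ˣ (w - f)` by a constant. -/
theorem hasDivADx_resolvent (ha : WeaklyDegenerate a) (w : L2Ω) :
    HasDivADx a (resolvent ha.embedding w) (resolvent ha.embedding w - w) := by
  set v := adjoint ha.embedding w with hv
  set f := ha.embedding v with hf
  set p := ha.weightedDeriv v with hp
  have hfp : HasSqrtADx a f p := ha.hasSqrtADx_embedding v
  change HasDivADx a f (f - w)
  set g := w - f with hg
  have hgi : Integrable g μΩ := (Lp.memLp g).integrable (by norm_num)
  set G : ℝ → ℝ := fun x => ∫ s in (0 : ℝ)..x, g s with hG
  have hGac : AbsolutelyContinuousOnInterval G 0 1 := absolutelyContinuous_primitive hgi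
  have hGd : deriv G =ᵐ[μΩ] g := deriv_primitive_ae hgi
  have hG0 : G 0 = 0 := intervalIntegral.integral_same
  -- the element `G/√a` of `L²(0,1)`
  have hGr : MemLp (fun x => G x * ha.invSqrt x) 2 μΩ := by
    obtain ⟨C, hC⟩ := hGac.exists_bound
    have hGc := hGac.continuousOn
    rw [uIcc_of_le zero_le_one] at hC hGc
    refine (Lp.memLp ha.invSqrt).of_le_mul (c := C)
      (((hGc.mono Ioo_subset_Icc_self).aestronglyMeasurable measurableSet_Ioo).mul
        (Lp.aestronglyMeasurable _)) ?_
    filter_upwards [ae_mem_unitInterval] with x hx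
    rw [norm_mul]
    exact mul_le_mul_of_nonneg_right (hC x (Ioo_subset_Icc_self hx)) (norm_nonneg _)
  set y := p + hGr.toLp with hy
  have horth : ∀ ψ, ⟪ha.invSqrt, ψ⟫ = 0 → ⟪y, ψ⟫ = 0 := fun ψ hψ => by
    have hφ : HasSqrtADx a (ha.primitiveL ψ) ψ := ha.hasSqrtADx_iff.2 ⟨rfl, hψ⟩
    have h1 := ha.inner_adjoint_embedding w hφ
    have h2 : ⟪p, ψ⟫ = ⟪g, ha.primitiveL ψ⟫ := by
      rw [hg, inner_sub_left]
      linarith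
    have h3 : ⟪g, ha.primitiveL ψ⟫ = ∫ x in (0 : ℝ)..1, deriv G x * ha.weightedPrimitive ψ x := by
      rw [inner_L2Ω]
      refine integral_congr_μΩ ?_ (right_mem_Icc.2 zero_le_one)
      filter_upwards [hGd, ha.coeFn_primitiveL ψ] with x h1 h2
      rw [h1, h2]
    have h4 : ⟪hGr.toLp, ψ⟫ = ∫ x in (0 : ℝ)..1, G x * deriv (ha.weightedPrimitive ψ) x := by
      rw [inner_L2Ω]
      refine integral_congr_μΩ ?_ (right_mem_Icc.2 zero_le_one)
      filter_upwards [hGr.coeFn_toLp, ha.deriv_weightedPrimitive ψ, ha.coeFn_invSqrt]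
        with x h1 h2 h3
      rw [h1, h2, h3]
      ring
    have h5 := hGac.integral_mul_deriv_eq_deriv_mul (ha.absolutelyContinuous_weightedPrimitive ψ)
    rw [weightedPrimitive_one, hψ, hG0, ← h3, ← h4] at h5
    rw [hy, inner_add_left, h2, h5]
    ring
  obtain ⟨c, hc⟩ : ∃ c : ℝ, c • ha.invSqrt = y := by
    rw [← Submodule.mem_span_singleton, ← Submodule.orthogonal_orthogonal (ℝ ∙ ha.invSqrt),
      Submodule.mem_orthogonal']
    intro ψ hψ
    exact horth ψ (Submodule.mem_orthogonal_singleton_iff_inner_right.1 hψ)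
  have hpc : ∀ᵐ x ∂μΩ, p x = (c - G x) * (√(a x))⁻¹ := by
    have h1 : p = c • ha.invSqrt - hGr.toLp := by rw [hc, hy, add_sub_cancel_right]
    rw [h1]
    filter_upwards [Lp.coeFn_sub (c • ha.invSqrt) hGr.toLp, Lp.coeFn_smul c ha.invSqrt,
      hGr.coeFn_toLp, ha.coeFn_invSqrt] with x h1 h2 h3 h4
    rw [h1, Pi.sub_apply, h2, h3, Pi.smul_apply, h4, smul_eq_mul]
    ring
  obtain ⟨F, hF, hpF⟩ := hfp
  refine ⟨⟨p, F, hF, hpF⟩, F, fun x => c - G x, hF, ?_, ?_, ?_⟩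
  · have hcac : AbsolutelyContinuousOnInterval (fun _ : ℝ => c) 0 1 :=
      (LipschitzWith.const c).lipschitzOnWith.absolutelyContinuousOnInterval
    exact hcac.sub hGac
  · filter_upwards [hpc, hpF, ae_mem_unitInterval] with x h1 h2 hx
    have hax := ha.pos x (Ioo_subset_Ioc_self hx)
    have h3 := (Real.sqrt_pos.2 hax).ne'
    have h4 := Real.mul_self_sqrt hax.le
    have h5 : √(a x) * p x = c - G x := by
      rw [h1]
      field_simp
    rw [← h5, h2, ← mul_assoc, h4]
  · filter_upwards [Lp.coeFn_sub f w, Lp.coeFn_sub w f, hGd] with x h1 h2 h3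
    rw [deriv_const_sub, h3, hg, h1, h2, Pi.sub_apply, Pi.sub_apply]
    ring

/-- Smooth functions with compact support in `(0,1)` belong to `H¹ₐ(0,1)`. -/
lemma exists_hasSqrtADx_of_contDiff (ha : WeaklyDegenerate a) {φ : ℝ → ℝ} (hφ : ContDiff ℝ ∞ φ)
    (hs : tsupport φ ⊆ Ioo 0 1) :
    ∃ f p : L2Ω, HasSqrtADx a f p ∧ f =ᵐ[μΩ] φ := by
  have hφ1 : ContDiff ℝ 1 φ := hφ.of_le (by exact_mod_cast le_top)
  have hb : ∀ ψ : ℝ → ℝ, ContinuousOn ψ (Icc 0 1) → MemLp ψ 2 μΩ := fun ψ hψ => by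
    obtain ⟨C, hC⟩ := isCompact_Icc.exists_bound_of_continuousOn hψ
    refine MemLp.of_bound ((hψ.mono Ioo_subset_Icc_self).aestronglyMeasurable measurableSet_Ioo)
      C ?_
    filter_upwards [ae_mem_unitInterval] with x hx
    exact hC x (Ioo_subset_Icc_self hx)
  have h1 := hb φ hφ.continuous.continuousOn
  have h2 := hb (fun x => √(a x) * deriv φ x)
    (ha.continuousOn.sqrt.mul (hφ1.continuous_deriv le_rfl).continuousOn)
  have h0 : ∀ x, x ∉ Ioo (0 : ℝ) 1 → φ x = 0 := fun x hx =>
    image_eq_zero_of_notMem_tsupport fun h => hx (hs h)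
  exact ⟨h1.toLp, h2.toLp, ⟨φ, ⟨hφ1.contDiffOn.absolutelyContinuousOnInterval, h0 0 (by simp),
    h0 1 (by simp), h1.coeFn_toLp⟩, h2.coeFn_toLp⟩, h1.coeFn_toLp⟩

/-- `H¹ₐ(0,1)` is dense in `L²(0,1)`, so that the adjoint of the inclusion is injective. -/
theorem adjoint_embedding_injective (ha : WeaklyDegenerate a) (w : L2Ω)
    (hw : adjoint ha.embedding w = 0) : w = 0 := by
  have h : ∀ᵐ x ∂(volume : Measure ℝ), x ∈ Ioo (0 : ℝ) 1 → w x = 0 := by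
    have hi : IntegrableOn w (Ioo 0 1) volume := (Lp.memLp w).integrable (by norm_num)
    refine isOpen_Ioo.ae_eq_zero_of_integral_contDiff_smul_eq_zero hi.locallyIntegrableOn
      fun φ hφ _ hs => ?_
    · obtain ⟨f, p, hfp, hf⟩ := ha.exists_hasSqrtADx_of_contDiff hφ hs
      have h1 := ha.inner_adjoint_embedding w hfp
      rw [hw, map_zero, map_zero, inner_zero_left, inner_zero_left, add_zero, inner_L2Ω,
        ← integral_μΩ] at h1
      have h2 : ∫ x in Ioo (0 : ℝ) 1, φ x • w x = ∫ x, φ x • w x :=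
        setIntegral_eq_integral_of_forall_compl_eq_zero fun x hx => by
          rw [image_eq_zero_of_notMem_tsupport fun h => hx (hs h), zero_smul]
      rw [← h2]
      refine Eq.trans ?_ h1.symm
      refine integral_congr_ae ?_
      filter_upwards [hf] with x hx
      rw [hx, smul_eq_mul, mul_comm]
  ext1
  filter_upwards [(ae_restrict_iff' measurableSet_Ioo).2 h, Lp.coeFn_zero ℝ 2 μΩ] with x h1 h2
  rw [h1, h2]
  rfl

end WeaklyDegenerate

/-! ### Time-dependent operators and multiplication by the coefficients -/

section PointwiseOperators

variable {E F : Type*} [NormedAddCommGroup E] [NormedSpace ℝ E] [SecondCountableTopology E]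
  [NormedAddCommGroup F] [NormedSpace ℝ F]

/-- A strongly measurable, uniformly bounded family of operators acts on `L²` functions. -/
lemma exists_pointwiseOp {μ : Measure ℝ} {B : ℝ → E →L[ℝ] F}
    (hB : ∀ x, StronglyMeasurable fun t => B t x) {m : ℝ} (hm : ∀ t x, ‖B t x‖ ≤ m * ‖x‖) :
    ∃ L : Lp E 2 μ →L[ℝ] Lp F 2 μ, (∀ f, L f =ᵐ[μ] fun t => B t (f t)) ∧
      ∀ f, ‖L f‖ ≤ m * ‖f‖ := by
  have hmem : ∀ f : Lp E 2 μ, MemLp (fun t => B t (f t)) 2 μ := fun f => by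
    borelize E
    have h1 : StronglyMeasurable (Function.uncurry fun x t => B t x) :=
      stronglyMeasurable_uncurry_of_continuous_of_stronglyMeasurable
        (fun t => (B t).continuous) hB
    have h2 : StronglyMeasurable fun t => B t (f t) :=
      h1.comp_measurable ((Lp.stronglyMeasurable f).measurable.prodMk measurable_id)
    exact (Lp.memLp f).of_le_mul h2.aestronglyMeasurable (Filter.Eventually.of_forall fun t =>
      hm t (f t))
  refine ⟨LinearMap.mkContinuous
    { toFun := fun f => (hmem f).toLp
      map_add' := fun f g => by
        rw [← MemLp.toLp_add]
        refine MemLp.toLp_congr _ _ ?_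
        filter_upwards [Lp.coeFn_add f g] with t h
        rw [h, Pi.add_apply, map_add, Pi.add_apply]
      map_smul' := fun c f => by
        rw [RingHom.id_apply, ← MemLp.toLp_const_smul]
        refine MemLp.toLp_congr _ _ ?_
        filter_upwards [Lp.coeFn_smul c f] with t h
        rw [h, Pi.smul_apply, map_smul, Pi.smul_apply] } m ?_, fun f => (hmem f).coeFn_toLp, ?_⟩
  all_goals
    intro f
    refine Lp.norm_le_mul_norm_of_ae_le_mul ?_
    filter_upwards [(hmem f).coeFn_toLp] with t h
    refine le_trans (le_of_eq ?_) (hm t (f t))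
    exact congrArg norm h

end PointwiseOperators

instance : SecondCountableTopology L2Ω :=
  haveI : Fact ((2 : ℝ≥0∞) ≠ ⊤) := ⟨by norm_num⟩
  inferInstance

lemma measurable_of_measurable_dist {X E : Type*} [MeasurableSpace X] [PseudoMetricSpace E]
    [SecondCountableTopology E] [MeasurableSpace E] [BorelSpace E] {f : X → E}
    (h : ∀ c, Measurable fun x => dist (f x) c) : Measurable f := by
  refine measurable_of_isOpen fun U hU => ?_
  obtain ⟨S, hS, hSU⟩ := TopologicalSpace.isOpen_iUnion_countable
    (fun q : {q : E × ℝ // Metric.ball q.1 q.2 ⊆ U} => Metric.ball q.1.1 q.1.2)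
    fun _ => Metric.isOpen_ball
  have hU' : U = ⋃ q : {q : E × ℝ // Metric.ball q.1 q.2 ⊆ U}, Metric.ball q.1.1 q.1.2 := by
    refine Subset.antisymm (fun y hy => ?_) (iUnion_subset fun q => q.2)
    obtain ⟨r, hr, hrU⟩ := Metric.isOpen_iff.1 hU y hy
    exact mem_iUnion.2 ⟨⟨(y, r), hrU⟩, Metric.mem_ball_self hr⟩
  rw [hU', ← hSU, preimage_iUnion₂]
  exact MeasurableSet.biUnion hS fun q _ => measurableSet_lt (h q.1.1) measurable_const

lemma norm_L2Ω (f : L2Ω) : ‖f‖ = √(∫ x, f x ^ 2 ∂μΩ) := by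
  rw [← Real.sqrt_sq (norm_nonneg f), ← real_inner_self_eq_norm_sq, inner_L2Ω, integral_μΩ]
  simp_rw [sq]

/-- Multiplication of `L²(0,1)` by a coefficient `c(·,t)`, as a strongly measurable family of
operators. -/
lemma exists_mulOp {T M : ℝ} (hM : 0 ≤ M) {c : ℝ → ℝ → ℝ} (hc : BoundedOnQ T M c) :
    ∃ B : ℝ → L2Ω →L[ℝ] L2Ω, (∀ g, StronglyMeasurable fun t => B t g) ∧
      (∀ t g, ‖B t g‖ ≤ M * ‖g‖) ∧
      ∀ᵐ t ∂(μT T), ∀ g, B t g =ᵐ[μΩ] fun x => c x t * g x := by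
  obtain ⟨hcm, hcM⟩ := hc
  -- a representative that is measurable and bounded everywhere
  set d : ℝ × ℝ → ℝ := fun z => max (-M) (min M (hcm.mk _ z)) with hd
  have hdm : StronglyMeasurable d :=
    (measurable_const.max (measurable_const.min
      hcm.stronglyMeasurable_mk.measurable)).stronglyMeasurable
  have hdM : ∀ z, |d z| ≤ M := fun z => abs_le.2
    ⟨le_max_left _ _, max_le (by linarith) (min_le_left _ _)⟩
  have hdc : ∀ᵐ z ∂(μQ T), d z = c z.1 z.2 := by
    filter_upwards [hcm.ae_eq_mk, hcM] with z h1 h2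
    rw [hd]
    dsimp only
    rw [← h1, min_eq_right (abs_le.1 h2).2, max_eq_right (abs_le.1 h2).1]
  have hsec : ∀ t, StronglyMeasurable fun x => d (x, t) := fun t =>
    hdm.comp_measurable (by fun_prop)
  have hmem : ∀ t (g : L2Ω), MemLp (fun x => d (x, t) * g x) 2 μΩ := fun t g => by
    refine (Lp.memLp g).of_le_mul (c := M)
      ((hsec t).aestronglyMeasurable.mul (Lp.aestronglyMeasurable g))
      (Filter.Eventually.of_forall fun x => ?_)
    rw [norm_mul]
    exact mul_le_mul_of_nonneg_right (hdM _) (norm_nonneg _)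
  have hbd : ∀ t (g : L2Ω), ‖(hmem t g).toLp‖ ≤ M * ‖g‖ := fun t g => by
    refine Lp.norm_le_mul_norm_of_ae_le_mul ?_
    filter_upwards [(hmem t g).coeFn_toLp] with x h
    rw [h, norm_mul]
    exact mul_le_mul_of_nonneg_right (hdM _) (norm_nonneg _)
  refine ⟨fun t => LinearMap.mkContinuous
    { toFun := fun g => (hmem t g).toLp
      map_add' := fun f g => by
        rw [← MemLp.toLp_add]
        refine MemLp.toLp_congr _ _ ?_
        filter_upwards [Lp.coeFn_add f g] with x h
        rw [h, Pi.add_apply, mul_add, Pi.add_apply]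
      map_smul' := fun s f => by
        rw [RingHom.id_apply, ← MemLp.toLp_const_smul]
        refine MemLp.toLp_congr _ _ ?_
        filter_upwards [Lp.coeFn_smul s f] with x h
        rw [h, Pi.smul_apply, Pi.smul_apply, smul_eq_mul, smul_eq_mul]
        ring } M (hbd t), fun g => ?_, hbd, ?_⟩
  -- `t ↦ d(·,t) g` is measurable since its distances to fixed elements are, by Fubini
  · borelize L2Ω
    refine Measurable.stronglyMeasurable (measurable_of_measurable_dist fun e => ?_)
    have h1 : ∀ t, dist ((hmem t g).toLp) e = √(∫ x, (d (x, t) * g x - e x) ^ 2 ∂μΩ) :=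
      fun t => by
        rw [dist_eq_norm, norm_L2Ω]
        congr 1
        refine integral_congr_ae ?_
        filter_upwards [Lp.coeFn_sub ((hmem t g).toLp) e, (hmem t g).coeFn_toLp] with x h1 h2
        rw [h1, Pi.sub_apply, h2]
    change Measurable fun t => dist ((hmem t g).toLp) e
    simp_rw [h1]
    have h2 : StronglyMeasurable fun z : ℝ × ℝ => (d (z.2, z.1) * g z.2 - e z.2) ^ 2 :=
      (((hdm.comp_measurable measurable_swap).mul
        ((Lp.stronglyMeasurable g).comp_measurable measurable_snd)).sub
        ((Lp.stronglyMeasurable e).comp_measurable measurable_snd)).pow 2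
    exact h2.integral_prod_right'.measurable.sqrt
  · have hQ : μQ T = μΩ.prod (μT T) := by
      rw [μQ, μΩ, μT, Measure.prod_restrict]
      rfl
    rw [hQ] at hdc
    have h1 := Measure.ae_ae_of_ae_prod
      (Measure.measurePreserving_swap.quasiMeasurePreserving.ae hdc : ∀ᵐ z ∂((μT T).prod μΩ), _)
    filter_upwards [h1] with t ht g
    refine (hmem t g).coeFn_toLp.trans ?_
    filter_upwards [ht] with x hx
    exact congrArg (· * g x) hx

/-- Extension by zero from `ω = (α,β)` to `(0,1)`. -/
lemma exists_extendZero {α β : ℝ} (hα : 0 ≤ α) (hβ : β ≤ 1) :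
    ∃ L : Lp ℝ 2 (volume.restrict (Ioo α β)) →L[ℝ] L2Ω,
      (∀ g, L g =ᵐ[μΩ] (Ioo α β).indicator g) ∧ ‖L‖ ≤ 1 := by
  have hr : μΩ.restrict (Ioo α β) = volume.restrict (Ioo α β) := by
    rw [Measure.restrict_restrict measurableSet_Ioo,
      inter_eq_left.2 (Ioo_subset_Ioo hα hβ)]
  have hmem : ∀ g : Lp ℝ 2 (volume.restrict (Ioo α β)), MemLp ((Ioo α β).indicator g) 2 μΩ :=
    fun g => by
      rw [memLp_indicator_iff_restrict measurableSet_Ioo, hr]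
      exact Lp.memLp g
  have hadd : ∀ {f g : ℝ → ℝ}, f =ᵐ[volume.restrict (Ioo α β)] g →
      (Ioo α β).indicator f =ᵐ[μΩ] (Ioo α β).indicator g := fun h => by
    rw [← hr] at h
    exact (ae_eq_restrict_iff_indicator_ae_eq measurableSet_Ioo).1 h
  refine ⟨LinearMap.mkContinuous
    { toFun := fun g => (hmem g).toLp
      map_add' := fun f g => by
        rw [← MemLp.toLp_add]
        refine MemLp.toLp_congr _ _ ?_
        rw [← indicator_add']
        exact hadd (Lp.coeFn_add f g)
      map_smul' := fun s f => by
        rw [RingHom.id_apply, ← MemLp.toLp_const_smul]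
        refine MemLp.toLp_congr _ _ ?_
        refine (hadd (Lp.coeFn_smul s f)).trans (Filter.Eventually.of_forall fun x => ?_)
        exact indicator_const_smul_apply (Ioo α β) s f x } 1 ?_, fun g => (hmem g).coeFn_toLp,
    LinearMap.mkContinuous_norm_le _ zero_le_one _⟩
  intro g
  refine le_of_eq ?_
  rw [one_mul]
  change ‖(hmem g).toLp‖ = _
  rw [Lp.norm_toLp, Lp.norm_def, eLpNorm_indicator_eq_eLpNorm_restrict measurableSet_Ioo, hr]

/-! ### Time derivatives -/

section TimeDerivative

variable {T : ℝ}

lemma HasTimeDeriv.ae_eq {u k k' : ℝ → L2Ω} (hT : 0 ≤ T) (h : HasTimeDeriv T u k)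
    (h' : HasTimeDeriv T u k') : k =ᵐ[μT T] k' := by
  have h0T : T ∈ Icc 0 T := right_mem_Icc.2 hT
  have d1 := (intervalIntegrable_of_memLp h.1 h0T).ae_hasDerivAt_integral
  have d2 := (intervalIntegrable_of_memLp h'.1 h0T).ae_hasDerivAt_integral
  filter_upwards [ae_restrict_of_ae d1, ae_restrict_of_ae d2, ae_mem_Ioo T] with t h1 h2 ht
  have hu : t ∈ uIcc 0 T := by
    rw [uIcc_of_le hT]
    exact Ioo_subset_Icc_self ht
  have e1 := h1 hu 0 left_mem_uIcc
  have e2 := h2 hu 0 left_mem_uIcc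
  have e : (fun x => ∫ s in (0 : ℝ)..x, k s) =ᶠ[nhds t] fun x => ∫ s in (0 : ℝ)..x, k' s := by
    filter_upwards [isOpen_Ioo.mem_nhds ht] with x hx
    have hx' := Ioo_subset_Icc_self hx
    exact add_left_cancel ((h.2 x hx').symm.trans (h'.2 x hx'))
  exact (e1.congr_of_eventuallyEq e.symm).unique e2

lemma MemH1L2.hasTimeDeriv {u : ℝ → L2Ω} (h : MemH1L2 T u) : HasTimeDeriv T u (timeDeriv T u) := by
  rw [timeDeriv, dif_pos h]
  exact h.choose_spec

lemma HasTimeDeriv.timeDeriv_ae_eq {u k : ℝ → L2Ω} (hT : 0 ≤ T) (h : HasTimeDeriv T u k) :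
    timeDeriv T u =ᵐ[μT T] k :=
  (MemH1L2.hasTimeDeriv ⟨k, h⟩).ae_eq hT h

lemma HasTimeDeriv.sub {u v k l : ℝ → L2Ω} (h : HasTimeDeriv T u k) (h' : HasTimeDeriv T v l) :
    HasTimeDeriv T (fun t => u t - v t) (fun t => k t - l t) := by
  refine ⟨h.1.sub h'.1, fun t ht => ?_⟩
  dsimp only
  rw [h.2 t ht, h'.2 t ht, intervalIntegral.integral_sub (intervalIntegrable_of_memLp h.1 ht)
    (intervalIntegrable_of_memLp h'.1 ht)]
  abel

end TimeDerivative

/-! ### The equations as identities in `L²(0,1)` -/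

section Equation

/-- An equation that holds almost everywhere in `(0,1)`, as an identity in `L²(0,1)`. -/
lemma equation_iff {τ q p u v r : L2Ω} {s : ℝ} {A B D : L2Ω →L[ℝ] L2Ω} {α β δ ρ : ℝ → ℝ}
    (hA : ∀ g, A g =ᵐ[μΩ] fun x => α x * g x) (hB : ∀ g, B g =ᵐ[μΩ] fun x => β x * g x)
    (hD : ∀ g, D g =ᵐ[μΩ] fun x => δ x * g x) (hr : r =ᵐ[μΩ] ρ) :
    (∀ᵐ x ∂μΩ, τ x - s * q x + α x * p x + β x * u x + δ x * v x = ρ x) ↔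
      τ - s • q + (A p + B u + D v) = r := by
  have h : ∀ᵐ x ∂μΩ, (τ - s • q + (A p + B u + D v) : L2Ω) x
      = τ x - s * q x + α x * p x + β x * u x + δ x * v x := by
    filter_upwards [Lp.coeFn_add (τ - s • q) (A p + B u + D v), Lp.coeFn_sub τ (s • q),
      Lp.coeFn_smul s q, Lp.coeFn_add (A p + B u) (D v), Lp.coeFn_add (A p) (B u), hA p, hB u,
      hD v] with x h1 h2 h3 h4 h5 h6 h7 h8
    rw [h1, Pi.add_apply, h2, Pi.sub_apply, h3, h4, Pi.add_apply, h5, Pi.add_apply, h6, h7, h8,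
      Pi.smul_apply, smul_eq_mul]
    ring
  constructor
  · intro he
    ext1
    filter_upwards [h, he, hr] with x h1 h2 h3
    rw [h1, h2, h3]
  · intro he
    rw [he] at h
    filter_upwards [h, hr] with x h1 h2
    rw [← h1, h2]

end Equation

lemma Coefficients.Admissible.nonneg {T b₀ M : ℝ} {c : Coefficients} (hc : c.Admissible T b₀ M)
    (hT : 0 < T) (hb₀ : 0 < b₀) : 0 ≤ M := by
  have : (ae (μT T)).NeBot := by
    rw [ae_neBot, Ne, Measure.restrict_eq_zero, Real.volume_Ioo, ENNReal.ofReal_eq_zero]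
    linarith
  obtain ⟨t, h1, h2⟩ := (hc.b_lower.and hc.b_upper).exists
  linarith

/-! ### Uniqueness -/

section Uniqueness

variable {T : ℝ}

lemma HasTimeDeriv.continuousOn {u k : ℝ → L2Ω} (hT : 0 ≤ T) (h : HasTimeDeriv T u k) :
    ContinuousOn u (Icc 0 T) :=
  (continuousOn_const.add (continuousOn_primitive hT h.1)).congr h.2

lemma HasTimeDeriv.memLp {u k : ℝ → L2Ω} (hT : 0 ≤ T) (h : HasTimeDeriv T u k) :
    MemLp u 2 (μT T) := by
  obtain ⟨C, hC⟩ := isCompact_Icc.exists_bound_of_continuousOn (h.continuousOn hT)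
  refine MemLp.of_bound (((h.continuousOn hT).mono Ioo_subset_Icc_self).aestronglyMeasurable
    measurableSet_Ioo) C ?_
  filter_upwards [ae_mem_Ioo T] with t ht
  exact hC t (Ioo_subset_Icc_self ht)

lemma integrable_inner_of_memLp {μ : Measure ℝ} {f g : ℝ → L2Ω} (hf : MemLp f 2 μ)
    (hg : MemLp g 2 μ) : Integrable (fun t => ⟪f t, g t⟫) μ := by
  refine (L2.integrable_inner (𝕜 := ℝ) hf.toLp hg.toLp).congr ?_
  filter_upwards [hf.coeFn_toLp, hg.coeFn_toLp] with t h1 h2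
  rw [h1, h2]

lemma HasTimeDeriv.energy_le {u k : ℝ → L2Ω} (hT : 0 ≤ T) {γ : ℝ} (hγ : 0 ≤ γ)
    (h : HasTimeDeriv T u k) (h0 : u 0 = 0) :
    γ * ∫ t, ⟪u t, u t⟫ ∂(expMeasure γ T) ≤ ∫ t, ⟪u t, k t⟫ ∂(expMeasure γ T) := by
  have hk := memLp_expMeasure hγ h.1
  have e := energy_inequality hT hγ (S := ContinuousLinearMap.id ℝ L2Ω) (fun _ _ => rfl)
    (fun x => real_inner_self_nonneg) 0 hk.toLp
  have hu : primitiveFrom hT hγ 0 hk.toLp =ᵐ[expMeasure γ T] u := by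
    filter_upwards [coeFn_primitiveFrom hT hγ 0 hk.toLp, ae_expMeasure_mem_Ioo γ T] with t h1 ht
    have ht' := Ioo_subset_Icc_self ht
    rw [h1, h.2 t ht', h0,
      primitive_congr ((absolutelyContinuous_expMeasure hγ T).ae_le hk.coeFn_toLp) ht']
  have hid := (ContinuousLinearMap.id ℝ L2Ω).coeFn_compLpL (p := 2)
    (primitiveFrom hT hγ 0 hk.toLp)
  rw [inner_zero_right, mul_zero, sub_zero, L2.inner_def, L2.inner_def] at e
  refine le_trans (le_of_eq ?_) (e.trans (le_of_eq ?_))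
  · congr 1
    refine integral_congr_ae ?_
    filter_upwards [hu, hid] with t h1 h2
    rw [h2, ContinuousLinearMap.id_apply, h1]
  · refine integral_congr_ae ?_
    filter_upwards [hu, hid, hk.coeFn_toLp] with t h1 h2 h3
    rw [h2, ContinuousLinearMap.id_apply, h1, h3]

/-- The `L²` energy estimate for one equation at a fixed time: the diffusion term absorbs the
first-order term `g`. -/
lemma inner_timeDeriv_le {H : Type*} [NormedAddCommGroup H] [InnerProductSpace ℝ H]
    {b₀ M s y : ℝ} (hb₀ : 0 < b₀) (hM : 0 ≤ M) (hs : b₀ ≤ s)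
    {k q p u g : H} (hq : ⟪q, u⟫ = -⟪p, p⟫) (hk : k - s • q + g = 0)
    (hg : ‖g‖ ≤ M * (‖p‖ + ‖u‖ + y)) :
    ⟪u, k⟫ ≤ (M ^ 2 / (4 * b₀) + 3 / 2 * M) * ‖u‖ ^ 2 + M / 2 * y ^ 2 := by
  have e : k = s • q - g := by
    rw [← sub_eq_zero, ← hk]
    abel
  have h1 : ⟪u, k⟫ = -(s * ‖p‖ ^ 2) - ⟪u, g⟫ := by
    rw [e, inner_sub_right, real_inner_smul_right, real_inner_comm, hq, real_inner_self_eq_norm_sq]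
    ring
  have h2 : -⟪u, g⟫ ≤ ‖u‖ * (M * (‖p‖ + ‖u‖ + y)) := by
    have := neg_le_of_abs_le (abs_real_inner_le_norm u g)
    have := mul_le_mul_of_nonneg_left hg (norm_nonneg u)
    linarith
  have h3 : b₀ * ‖p‖ ^ 2 ≤ s * ‖p‖ ^ 2 := by gcongr
  have h4 : M * ‖u‖ * ‖p‖ ≤ b₀ * ‖p‖ ^ 2 + M ^ 2 / (4 * b₀) * ‖u‖ ^ 2 := by
    have h := mul_nonneg hb₀.le (sq_nonneg (‖p‖ - M * ‖u‖ / (2 * b₀)))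
    have e : b₀ * (‖p‖ - M * ‖u‖ / (2 * b₀)) ^ 2
        = b₀ * ‖p‖ ^ 2 + M ^ 2 / (4 * b₀) * ‖u‖ ^ 2 - M * ‖u‖ * ‖p‖ := by
      field_simp
      ring
    linarith
  have h5 : M * (‖u‖ * y) ≤ M * (1 / 2 * ‖u‖ ^ 2 + 1 / 2 * y ^ 2) := by
    refine mul_le_mul_of_nonneg_left ?_ hM
    nlinarith [sq_nonneg (‖u‖ - y)]
  rw [h1]
  nlinarith

lemma norm_lowerOrder_le {M : ℝ} {A B D : L2Ω →L[ℝ] L2Ω} (hA : ∀ g, ‖A g‖ ≤ M * ‖g‖)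
    (hB : ∀ g, ‖B g‖ ≤ M * ‖g‖) (hD : ∀ g, ‖D g‖ ≤ M * ‖g‖) (p u v : L2Ω) :
    ‖A p + B u + D v‖ ≤ M * (‖p‖ + ‖u‖ + ‖v‖) := by
  have := norm_add₃_le (a := A p) (b := B u) (c := D v)
  have := hA p
  have := hB u
  have := hD v
  linarith

lemma inner_divADx_sub {a : ℝ → ℝ} (ha : WeaklyDegenerate a) {f f' : L2Ω} (h : MemH2a a f)
    (h' : MemH2a a f') :
    ⟪divADx a f - divADx a f', f - f'⟫
      = -⟪sqrtADx a f - sqrtADx a f', sqrtADx a f - sqrtADx a f'⟫ := by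
  have hs := h.memH1a.hasSqrtADx
  have hs' := h'.memH1a.hasSqrtADx
  rw [inner_sub_left, h.hasDivADx.inner_eq ha.pos hs (hs.sub hs'),
    h'.hasDivADx.inner_eq ha.pos hs' (hs.sub hs'), inner_sub_left]
  ring

/-- Two solutions of the system with the same data coincide. The weighted energy inequality for
their difference has the factor `γ` on the left and a constant independent of `γ` on the right. -/
theorem IsSolution.eqOn {b₀ M : ℝ} (hT : 0 < T) (hb₀ : 0 < b₀) {c : Coefficients}
    (hc : c.Admissible T b₀ M) {α β : ℝ} {u₀ v₀ : L2Ω}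
    {h : ℝ → Lp ℝ 2 (volume.restrict (Ioo α β))} {H₁ H₂ u v u' v' : ℝ → L2Ω}
    (hα : 0 ≤ α) (hβ : β ≤ 1)
    (hs : IsSolution T c α β u₀ v₀ h H₁ H₂ u v) (hs' : IsSolution T c α β u₀ v₀ h H₁ H₂ u' v') :
    EqOn u u' (Icc 0 T) ∧ EqOn v v' (Icc 0 T) := by
  have hM := hc.nonneg hT hb₀
  obtain ⟨A₁, -, hA₁, hA₁c⟩ := exists_mulOp hM hc.d₁_bdd
  obtain ⟨A₂, -, hA₂, hA₂c⟩ := exists_mulOp hM hc.d₂_bdd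
  obtain ⟨B₁₁, -, hB₁₁, hB₁₁c⟩ := exists_mulOp hM hc.b₁₁_bdd
  obtain ⟨B₁₂, -, hB₁₂, hB₁₂c⟩ := exists_mulOp hM hc.b₁₂_bdd
  obtain ⟨B₂₁, -, hB₂₁, hB₂₁c⟩ := exists_mulOp hM hc.b₂₁_bdd
  obtain ⟨B₂₂, -, hB₂₂, hB₂₂c⟩ := exists_mulOp hM hc.b₂₂_bdd
  obtain ⟨L, hL, -⟩ := exists_extendZero hα hβ
  set U : ℝ → L2Ω := fun t => u t - u' t with hU
  set V : ℝ → L2Ω := fun t => v t - v' t with hV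
  set k : ℝ → L2Ω := fun t => timeDeriv T u t - timeDeriv T u' t with hk
  set l : ℝ → L2Ω := fun t => timeDeriv T v t - timeDeriv T v' t with hl
  have hUk : HasTimeDeriv T U k := hs.u_memH1L2.hasTimeDeriv.sub hs'.u_memH1L2.hasTimeDeriv
  have hVl : HasTimeDeriv T V l := hs.v_memH1L2.hasTimeDeriv.sub hs'.v_memH1L2.hasTimeDeriv
  set C := M ^ 2 / (4 * b₀) + 2 * M with hC
  have hC0 : 0 ≤ C := by positivity
  -- the pointwise energy estimates
  have hUt : ∀ᵐ t ∂(μT T), ⟪U t, k t⟫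
      ≤ (M ^ 2 / (4 * b₀) + 3 / 2 * M) * ‖U t‖ ^ 2 + M / 2 * ‖V t‖ ^ 2 := by
    filter_upwards [hc.b_lower, hs.eq_u, hs'.eq_u, hs.u_memL2H2a.1, hs'.u_memL2H2a.1,
      hA₁c, hB₁₁c, hB₁₂c] with t hb e e' hu hu' h1 h2 h3
    have hr : (L (h t) + H₁ t : L2Ω) =ᵐ[μΩ] fun x => (Ioo α β).indicator (h t) x + H₁ t x := by
      filter_upwards [Lp.coeFn_add (L (h t)) (H₁ t), hL (h t)] with x e1 e2
      rw [e1, Pi.add_apply, e2]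
    rw [equation_iff h1 h2 h3 hr] at e e'
    refine inner_timeDeriv_le hb₀ hM hb (inner_divADx_sub hc.a_deg hu hu')
      (g := A₁ t (sqrtADx c.a (u t) - sqrtADx c.a (u' t)) + B₁₁ t (U t) + B₁₂ t (V t)) ?_
      (norm_lowerOrder_le (hA₁ t) (hB₁₁ t) (hB₁₂ t) _ _ _)
    rw [← sub_eq_zero.2 (e.trans e'.symm)]
    simp only [hU, hV, hk, map_sub, smul_sub]
    abel
  have hVt : ∀ᵐ t ∂(μT T), ⟪V t, l t⟫
      ≤ (M ^ 2 / (4 * b₀) + 3 / 2 * M) * ‖V t‖ ^ 2 + M / 2 * ‖U t‖ ^ 2 := by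
    filter_upwards [hc.b_lower, hs.eq_v, hs'.eq_v, hs.v_memL2H2a.1, hs'.v_memL2H2a.1,
      hA₂c, hB₂₁c, hB₂₂c] with t hb e e' hu hu' h1 h2 h3
    rw [equation_iff h1 h2 h3 (Filter.EventuallyEq.refl _ (H₂ t))] at e e'
    refine inner_timeDeriv_le hb₀ hM hb (inner_divADx_sub hc.a_deg hu hu')
      (g := A₂ t (sqrtADx c.a (v t) - sqrtADx c.a (v' t)) + B₂₁ t (U t) + B₂₂ t (V t)) ?_
      ((norm_lowerOrder_le (hA₂ t) (hB₂₁ t) (hB₂₂ t) _ _ _).trans (le_of_eq ?_))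
    · rw [← sub_eq_zero.2 (e.trans e'.symm)]
      simp only [hU, hV, hl, map_sub, smul_sub]
      abel
    · simp only [hU, hV]
      ring
  -- the weighted energy inequality with `γ = C + 1`
  have hγ : 0 ≤ C + 1 := by positivity
  have hUm := memLp_expMeasure hγ (hUk.memLp hT.le)
  have hVm := memLp_expMeasure hγ (hVl.memLp hT.le)
  have hkm := memLp_expMeasure hγ hUk.1
  have hlm := memLp_expMeasure hγ hVl.1
  have iU := integrable_inner_of_memLp hUm hUm
  have iV := integrable_inner_of_memLp hVm hVm
  have e1 := hUk.energy_le hT.le hγ (by simp [hU, hs.u_init, hs'.u_init])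
  have e2 := hVl.energy_le hT.le hγ (by simp [hV, hs.v_init, hs'.v_init])
  have e3 : ∫ t, (⟪U t, k t⟫ + ⟪V t, l t⟫) ∂(expMeasure (C + 1) T)
      ≤ ∫ t, C * (⟪U t, U t⟫ + ⟪V t, V t⟫) ∂(expMeasure (C + 1) T) := by
    refine integral_mono_ae ((integrable_inner_of_memLp hUm hkm).add
      (integrable_inner_of_memLp hVm hlm)) ((iU.add iV).const_mul C) ?_
    filter_upwards [(expMeasure_absolutelyContinuous (C + 1) T).ae_le hUt,
      (expMeasure_absolutelyContinuous (C + 1) T).ae_le hVt] with t h1 h2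
    rw [real_inner_self_eq_norm_sq, real_inner_self_eq_norm_sq]
    linarith
  rw [integral_add (integrable_inner_of_memLp hUm hkm) (integrable_inner_of_memLp hVm hlm),
    integral_const_mul, integral_add iU iV] at e3
  have nU : 0 ≤ ∫ t, ⟪U t, U t⟫ ∂(expMeasure (C + 1) T) :=
    integral_nonneg fun t => real_inner_self_nonneg
  have nV : 0 ≤ ∫ t, ⟪V t, V t⟫ ∂(expMeasure (C + 1) T) :=
    integral_nonneg fun t => real_inner_self_nonneg
  have zU : ∫ t, ⟪U t, U t⟫ ∂(expMeasure (C + 1) T) = 0 := by linarith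
  have zV : ∫ t, ⟪V t, V t⟫ ∂(expMeasure (C + 1) T) = 0 := by linarith
  have key : ∀ {f m : ℝ → L2Ω}, HasTimeDeriv T f m →
      Integrable (fun t => ⟪f t, f t⟫) (expMeasure (C + 1) T) →
      ∫ t, ⟪f t, f t⟫ ∂(expMeasure (C + 1) T) = 0 → EqOn f (fun _ => 0) (Icc 0 T) := by
    intro f m hf hi h0
    have h1 := (integral_eq_zero_iff_of_nonneg (fun t => real_inner_self_nonneg) hi).1 h0
    have h2 : f =ᵐ[volume.restrict (Icc 0 T)] fun _ => 0 := by
      rw [← restrict_Ioo_eq_restrict_Icc]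
      filter_upwards [(absolutelyContinuous_expMeasure hγ T).ae_le h1] with t ht
      exact inner_self_eq_zero.1 ht
    exact Measure.eqOn_Icc_of_ae_eq volume hT.ne h2 (hf.continuousOn hT.le) continuousOn_const
  exact ⟨fun t ht => sub_eq_zero.1 (key hUk iU zU ht), fun t ht => sub_eq_zero.1 (key hVl iV zV ht)⟩

end Uniqueness

/-! ### From the abstract solution space to functions of time -/

section Reconstruction

variable {T γ : ℝ}

lemma norm_sq_expMeasure (f : Lp L2Ω 2 (expMeasure γ T)) :
    ‖f‖ ^ 2 = ∫ t, ‖f t‖ ^ 2 ∂(expMeasure γ T) := by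
  rw [← real_inner_self_eq_norm_sq, L2.inner_def]
  exact integral_congr_ae (Filter.Eventually.of_forall fun t => real_inner_self_eq_norm_sq _)

lemma integrable_norm_sq {μ : Measure ℝ} {f : ℝ → L2Ω} (hf : MemLp f 2 μ) :
    Integrable (fun t => ‖f t‖ ^ 2) μ :=
  (integrable_inner_of_memLp hf hf).congr
    (Filter.Eventually.of_forall fun _ => real_inner_self_eq_norm_sq _)

lemma integral_norm_sq_le (hγ : 0 ≤ γ) (f : Lp L2Ω 2 (expMeasure γ T)) :
    ∫ t, ‖f t‖ ^ 2 ∂(μT T) ≤ Real.exp (γ * T) ^ 2 * ‖f‖ ^ 2 := by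
  have h := integral_mono_measure (f := fun t => ‖f t‖ ^ 2) (le_expMeasure (T := T) hγ)
    (Filter.Eventually.of_forall fun _ => sq_nonneg _)
    ((integrable_norm_sq (Lp.memLp f)).smul_measure ENNReal.ofReal_ne_top)
  rw [integral_smul_measure, ENNReal.toReal_ofReal (Real.exp_pos _).le, smul_eq_mul,
    ← norm_sq_expMeasure] at h
  rwa [← Real.exp_nat_mul, Nat.cast_ofNat, ← mul_assoc]

lemma sqrt_integral_le {G : ℝ → ℝ} {C y : ℝ} (hγ : 0 ≤ γ) (hC : 0 ≤ C)
    (f : Lp L2Ω 2 (expMeasure γ T)) (k : Lp L2Ω 2 (expMeasure γ T)) (hG0 : ∀ t, 0 ≤ G t)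
    (hG : ∀ᵐ t ∂(μT T), G t ≤ C ^ 2 * (‖f t‖ ^ 2 + ‖k t‖ ^ 2)) (hf : ‖f‖ ≤ y) (hk : ‖k‖ ≤ y) :
    √(∫ t, G t ∂(μT T)) ≤ 2 * C * Real.exp (γ * T) * y := by
  have hy : 0 ≤ y := (norm_nonneg f).trans hf
  refine Real.sqrt_le_iff.2 ⟨by positivity, ?_⟩
  have i1 := integrable_norm_sq (memLp_of_expMeasure hγ (Lp.memLp f))
  have i2 := integrable_norm_sq (memLp_of_expMeasure hγ (Lp.memLp k))
  have h1 : ∫ t, G t ∂(μT T) ≤ ∫ t, C ^ 2 * (‖f t‖ ^ 2 + ‖k t‖ ^ 2) ∂(μT T) :=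
    integral_mono_of_nonneg (Filter.Eventually.of_forall hG0) ((i1.add i2).const_mul _) hG
  rw [integral_const_mul, integral_add i1 i2] at h1
  have h2 := integral_norm_sq_le hγ f
  have h3 := integral_norm_sq_le hγ k
  have h4 : Real.exp (γ * T) ^ 2 * ‖f‖ ^ 2 ≤ Real.exp (γ * T) ^ 2 * y ^ 2 := by gcongr
  have h5 : Real.exp (γ * T) ^ 2 * ‖k‖ ^ 2 ≤ Real.exp (γ * T) ^ 2 * y ^ 2 := by gcongr
  calc ∫ t, G t ∂(μT T)
      ≤ C ^ 2 * (∫ t, ‖f t‖ ^ 2 ∂(μT T) + ∫ t, ‖k t‖ ^ 2 ∂(μT T)) := h1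
    _ ≤ C ^ 2 * (4 * (Real.exp (γ * T) ^ 2 * y ^ 2)) := by
        gcongr
        have : 0 ≤ Real.exp (γ * T) ^ 2 * y ^ 2 := by positivity
        linarith
    _ = (2 * C * Real.exp (γ * T) * y) ^ 2 := by ring

variable {ha : WeaklyDegenerate a} {hT : 0 ≤ T} {hγ : 0 ≤ γ}

/-- The function of time encoded by an element of `solutionSpace`. -/
def solutionFun (ha : WeaklyDegenerate a)
    (z : formSpace ha × Lp L2Ω 2 (expMeasure γ T) × Lp L2Ω 2 (expMeasure γ T)) (t : ℝ) : L2Ω :=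
  ha.embedding z.1 + ∫ s in (0 : ℝ)..t, z.2.1 s

variable {z : formSpace ha × Lp L2Ω 2 (expMeasure γ T) × Lp L2Ω 2 (expMeasure γ T)}

lemma solutionFun_zero (z : formSpace ha × Lp L2Ω 2 (expMeasure γ T) ×
    Lp L2Ω 2 (expMeasure γ T)) : solutionFun ha z 0 = ha.embedding z.1 := by
  rw [solutionFun, intervalIntegral.integral_same, add_zero]

lemma hasTimeDeriv_solutionFun (hγ : 0 ≤ γ)
    (z : formSpace ha × Lp L2Ω 2 (expMeasure γ T) × Lp L2Ω 2 (expMeasure γ T)) :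
    HasTimeDeriv T (solutionFun ha z) z.2.1 :=
  ⟨memLp_of_expMeasure hγ (Lp.memLp _), fun t _ => by rw [solutionFun_zero, solutionFun]⟩

lemma solutionFun_ae_eq (hz : z ∈ solutionSpace hT hγ ha.embedding) :
    ∀ᵐ t ∂(μT T), solutionFun ha z t = resolvent ha.embedding (z.2.2 t) := by
  refine (absolutelyContinuous_expMeasure hγ T).ae_le ?_
  have h := resolvent_eq_primitiveFrom hz
  filter_upwards [coeFn_primitiveFrom hT hγ (ha.embedding z.1) z.2.1,
    (resolvent ha.embedding).coeFn_compLpL (p := 2) z.2.2] with t h1 h2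
  rw [← h2, h, h1, solutionFun]

lemma sqrtADx_solutionFun (hz : z ∈ solutionSpace hT hγ ha.embedding) :
    ∀ᵐ t ∂(μT T), sqrtADx a (solutionFun ha z t)
      = ha.weightedDeriv (adjoint ha.embedding (z.2.2 t)) := by
  filter_upwards [solutionFun_ae_eq hz] with t h
  rw [h]
  exact (ha.hasSqrtADx_embedding _).sqrtADx_eq

lemma divADx_solutionFun (hz : z ∈ solutionSpace hT hγ ha.embedding) :
    ∀ᵐ t ∂(μT T), divADx a (solutionFun ha z t)
      = resolvent ha.embedding (z.2.2 t) - z.2.2 t := by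
  filter_upwards [solutionFun_ae_eq hz] with t h
  rw [h]
  exact (ha.hasDivADx_resolvent _).divADx_eq

lemma memL2H2a_solutionFun (hz : z ∈ solutionSpace hT hγ ha.embedding) :
    MemL2H2a T a (solutionFun ha z) := by
  have hw : MemLp z.2.2 2 (μT T) := memLp_of_expMeasure hγ (Lp.memLp _)
  refine ⟨?_, (hasTimeDeriv_solutionFun hγ z).memLp hT, ?_, ?_⟩
  · filter_upwards [solutionFun_ae_eq hz] with t h
    rw [h]
    exact ⟨_, ha.hasDivADx_resolvent _⟩
  · exact ((ha.weightedDeriv ∘L adjoint ha.embedding).comp_memLp' hw).ae_eq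
      (Filter.EventuallyEq.symm (sqrtADx_solutionFun hz))
  · exact (((resolvent ha.embedding).comp_memLp' hw).sub hw).ae_eq
      (Filter.EventuallyEq.symm (divADx_solutionFun hz))

lemma normE_solutionFun_le (hz : z ∈ solutionSpace hT hγ ha.embedding) {y : ℝ}
    (h1 : ‖z.2.1‖ ≤ y) (h2 : ‖z.2.2‖ ≤ y) :
    normE T a (solutionFun ha z) ≤ 8 * Real.exp (γ * T) * y := by
  have hD : ∀ w, ‖adjoint ha.embedding w‖ ≤ ‖w‖ := norm_adjoint_apply_le ha.norm_embedding_le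
  have hJ : ∀ w, ‖resolvent ha.embedding w‖ ≤ ‖w‖ := fun w =>
    (ha.norm_embedding_le _).trans (hD w)
  have e1 : normL2H2a T a (solutionFun ha z) ≤ 2 * 3 * Real.exp (γ * T) * y := by
    refine sqrt_integral_le hγ (by norm_num) z.2.2 z.2.1 (fun t => sq_nonneg _) ?_ h2 h1
    filter_upwards [solutionFun_ae_eq hz, sqrtADx_solutionFun hz, divADx_solutionFun hz]
      with t e1 e2 e3
    rw [normH2a, normH1a, Real.sq_sqrt (by positivity), Real.sq_sqrt (by positivity), e2, e3, e1]
    have a1 : ‖resolvent ha.embedding (z.2.2 t)‖ ^ 2 ≤ ‖z.2.2 t‖ ^ 2 := by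
      gcongr
      exact hJ _
    have a2 : ‖ha.weightedDeriv (adjoint ha.embedding (z.2.2 t))‖ ^ 2 ≤ ‖z.2.2 t‖ ^ 2 := by
      gcongr
      exact (ha.norm_weightedDeriv_le _).trans (hD _)
    have a3 : ‖resolvent ha.embedding (z.2.2 t) - z.2.2 t‖ ^ 2 ≤ (2 * ‖z.2.2 t‖) ^ 2 := by
      gcongr
      have := hJ (z.2.2 t)
      exact (norm_sub_le _ _).trans (by linarith)
    nlinarith [sq_nonneg ‖z.2.2 t‖, sq_nonneg ‖z.2.1 t‖]
  have e2 : normH1L2 T (solutionFun ha z) ≤ 2 * 1 * Real.exp (γ * T) * y := by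
    refine sqrt_integral_le hγ (by norm_num) z.2.2 z.2.1 (fun t => by positivity) ?_ h2 h1
    filter_upwards [solutionFun_ae_eq hz, (hasTimeDeriv_solutionFun hγ z).timeDeriv_ae_eq hT]
      with t e1 e2
    rw [e1, e2]
    have a1 : ‖resolvent ha.embedding (z.2.2 t)‖ ^ 2 ≤ ‖z.2.2 t‖ ^ 2 := by
      gcongr
      exact hJ _
    linarith
  rw [normE]
  linarith

end Reconstruction

/-! ### Existence and the a priori estimate -/

section Existence

variable {T γ : ℝ}

/-- Multiplication by `b`, which is only almost everywhere measurable and bounded, exists as a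
bounded operator. -/
lemma exists_isMul {b₀ M : ℝ} {b : ℝ → ℝ} (hM : 0 ≤ M) (hb₀ : 0 < b₀)
    (hbm : AEStronglyMeasurable b (μT T)) (hl : ∀ᵐ t ∂(μT T), b₀ ≤ b t)
    (hu : ∀ᵐ t ∂(μT T), b t ≤ M) (γ : ℝ) :
    ∃ β : Lp L2Ω 2 (expMeasure γ T) →L[ℝ] Lp L2Ω 2 (expMeasure γ T), IsMul b₀ M b β := by
  set d : ℝ → ℝ := fun t => max (-M) (min M (hbm.mk _ t)) with hd
  have hdm : StronglyMeasurable d :=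
    (measurable_const.max (measurable_const.min
      hbm.stronglyMeasurable_mk.measurable)).stronglyMeasurable
  have hdM : ∀ t, |d t| ≤ M := fun t => abs_le.2
    ⟨le_max_left _ _, max_le (by linarith) (min_le_left _ _)⟩
  have hac := expMeasure_absolutelyContinuous γ T
  obtain ⟨β, hβ, -⟩ := exists_pointwiseOp (μ := expMeasure γ T)
    (B := fun t => d t • ContinuousLinearMap.id ℝ L2Ω) (m := M)
    (fun x => hdm.smul_const x) (fun t x => by
      change ‖d t • x‖ ≤ _
      rw [norm_smul]
      exact mul_le_mul_of_nonneg_right (hdM t) (norm_nonneg _))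
  refine ⟨β, fun f => ?_, hac.ae_le hl, hac.ae_le hu⟩
  filter_upwards [hβ f, hac.ae_le hbm.ae_eq_mk, hac.ae_le hl, hac.ae_le hu] with t h1 h2 h3 h4
  rw [h1, hd]
  change max (-M) (min M (hbm.mk _ t)) • f t = _
  rw [← h2, min_eq_right h4, max_eq_right (by linarith)]

lemma norm_toLp_expMeasure_le (hγ : 0 ≤ γ) (f : Lp L2Ω 2 (μT T)) :
    ‖(memLp_expMeasure hγ (Lp.memLp f)).toLp f‖ ≤ ‖f‖ := by
  rw [Lp.norm_toLp, Lp.norm_def]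
  refine ENNReal.toReal_mono (Lp.memLp f).eLpNorm_ne_top ?_
  refine (eLpNorm_le_of_measure_le_smul (expMeasure_le hγ)).trans (le_of_eq ?_)
  rw [ENNReal.one_rpow, one_smul]

/-- The lower-order terms `d √a u_x + b u + b̃ v` of one equation, as a bounded operator on pairs
of functions with values in a form domain `V`, where `Λ` stands for `√a ∂ₓ`. -/
lemma exists_lowerOrderOp {V : Type*} [NormedAddCommGroup V] [NormedSpace ℝ V]
    {M : ℝ} (hM : 0 ≤ M) {Λ π : V →L[ℝ] L2Ω} (hΛ : ∀ v, ‖Λ v‖ ≤ ‖v‖) (hπ : ∀ v, ‖π v‖ ≤ ‖v‖)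
    {A B D : ℝ → L2Ω →L[ℝ] L2Ω} (hA : ∀ g, StronglyMeasurable fun t => A t g)
    (hB : ∀ g, StronglyMeasurable fun t => B t g) (hD : ∀ g, StronglyMeasurable fun t => D t g)
    (hAM : ∀ t g, ‖A t g‖ ≤ M * ‖g‖) (hBM : ∀ t g, ‖B t g‖ ≤ M * ‖g‖)
    (hDM : ∀ t g, ‖D t g‖ ≤ M * ‖g‖) (μ : Measure ℝ) :
    ∃ R : Lp V 2 μ × Lp V 2 μ →L[ℝ] Lp L2Ω 2 μ,
      (∀ p, ‖R p‖ ≤ (2 * M + 1) * (‖p.1‖ + ‖p.2‖)) ∧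
      ∀ p, R p =ᵐ[μ] fun t => A t (Λ (p.1 t)) + B t (π (p.1 t)) + D t (π (p.2 t)) := by
  obtain ⟨A', hA', hAn⟩ := exists_pointwiseOp (μ := μ) hA hAM
  obtain ⟨B', hB', hBn⟩ := exists_pointwiseOp (μ := μ) hB hBM
  obtain ⟨D', hD', hDn⟩ := exists_pointwiseOp (μ := μ) hD hDM
  have lift : ∀ ρ : V →L[ℝ] L2Ω, (∀ v, ‖ρ v‖ ≤ ‖v‖) → ∀ f : Lp V 2 μ, ‖ρ.compLpL 2 μ f‖ ≤ ‖f‖ := by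
    intro ρ hρ f
    refine Lp.norm_le_norm_of_ae_le ?_
    filter_upwards [ρ.coeFn_compLpL (p := 2) f] with t h
    rw [h]
    exact hρ _
  obtain ⟨R, hR⟩ : ∃ R : Lp V 2 μ × Lp V 2 μ →L[ℝ] Lp L2Ω 2 μ, ∀ p, R p =
      A' (Λ.compLpL 2 μ p.1) + B' (π.compLpL 2 μ p.1) + D' (π.compLpL 2 μ p.2) :=
    ⟨(A' ∘L Λ.compLpL 2 μ + B' ∘L π.compLpL 2 μ) ∘L
      ContinuousLinearMap.fst ℝ (Lp V 2 μ) (Lp V 2 μ) + (D' ∘L π.compLpL 2 μ) ∘L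
      ContinuousLinearMap.snd ℝ (Lp V 2 μ) (Lp V 2 μ), fun p => rfl⟩
  refine ⟨R, fun p => ?_, fun p => ?_⟩
  rotate_left
  · rw [hR p]
    filter_upwards [Lp.coeFn_add (A' (Λ.compLpL 2 μ p.1) + B' (π.compLpL 2 μ p.1))
        (D' (π.compLpL 2 μ p.2)),
      Lp.coeFn_add (A' (Λ.compLpL 2 μ p.1)) (B' (π.compLpL 2 μ p.1)),
      hA' (Λ.compLpL 2 μ p.1), hB' (π.compLpL 2 μ p.1), hD' (π.compLpL 2 μ p.2),
      Λ.coeFn_compLpL (p := 2) p.1, π.coeFn_compLpL (p := 2) p.1, π.coeFn_compLpL (p := 2) p.2]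
      with t h1 h2 h3 h4 h5 h6 h7 h8
    rw [h1, Pi.add_apply, h2, Pi.add_apply, h3, h4, h5, h6, h7, h8]
  · rw [hR p]
    have h0 := norm_add₃_le (a := A' (Λ.compLpL 2 μ p.1))
      (b := B' (π.compLpL 2 μ p.1)) (c := D' (π.compLpL 2 μ p.2))
    have h1 := (hAn (Λ.compLpL 2 μ p.1)).trans (mul_le_mul_of_nonneg_left (lift Λ hΛ p.1) hM)
    have h2 := (hBn (π.compLpL 2 μ p.1)).trans (mul_le_mul_of_nonneg_left (lift π hπ p.1) hM)
    have h3 := (hDn (π.compLpL 2 μ p.2)).trans (mul_le_mul_of_nonneg_left (lift π hπ p.2) hM)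
    have h4 := mul_nonneg hM (norm_nonneg p.2)
    have h5 := norm_nonneg p.1
    have h6 := norm_nonneg p.2
    have h7 : (2 * M + 1) * (‖p.1‖ + ‖p.2‖) = M * ‖p.1‖ + M * ‖p.1‖ + 2 * (M * ‖p.2‖) +
        ‖p.1‖ + ‖p.2‖ := by ring
    linarith

lemma exists_comp_swap {X Y : Type*} [NormedAddCommGroup X] [NormedSpace ℝ X]
    [NormedAddCommGroup Y] [NormedSpace ℝ Y] (S : X × X →L[ℝ] Y) :
    ∃ S' : X × X →L[ℝ] Y, ∀ p, S' p = S (p.2, p.1) :=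
  ⟨S ∘L (ContinuousLinearMap.snd ℝ X X).prod (ContinuousLinearMap.fst ℝ X X), fun _ => rfl⟩

/-- Solvability of the system with lower-order terms of the concrete form, for an abstract form
domain `V`. -/
lemma exists_weak_solution {V : Type*} [NormedAddCommGroup V] [InnerProductSpace ℝ V]
    [CompleteSpace V] (hT : 0 ≤ T) (hγ : 0 ≤ γ) {b₀ M : ℝ} (hb₀ : 0 < b₀) (hM : 0 ≤ M) {b : ℝ → ℝ}
    {β : Lp L2Ω 2 (expMeasure γ T) →L[ℝ] Lp L2Ω 2 (expMeasure γ T)} (hβ : IsMul b₀ M b β)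
    {Λ π : V →L[ℝ] L2Ω} (hΛ : ∀ v, ‖Λ v‖ ≤ ‖v‖) (hπ : ∀ v, ‖π v‖ ≤ ‖v‖)
    (hinj : ∀ v, π v = 0 → v = 0) (hD : ∀ w, adjoint π w = 0 → w = 0)
    (hMγ : M + (1 / 2 + 1 / (2 * b₀)) * (4 * (2 * M + 1)) ^ 2 ≤ γ)
    {A₁ B₁ D₁ A₂ B₂ D₂ : ℝ → L2Ω →L[ℝ] L2Ω}
    (hA₁ : ∀ g, StronglyMeasurable fun t => A₁ t g) (hB₁ : ∀ g, StronglyMeasurable fun t => B₁ t g)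
    (hD₁ : ∀ g, StronglyMeasurable fun t => D₁ t g) (hA₂ : ∀ g, StronglyMeasurable fun t => A₂ t g)
    (hB₂ : ∀ g, StronglyMeasurable fun t => B₂ t g) (hD₂ : ∀ g, StronglyMeasurable fun t => D₂ t g)
    (hA₁M : ∀ t g, ‖A₁ t g‖ ≤ M * ‖g‖) (hB₁M : ∀ t g, ‖B₁ t g‖ ≤ M * ‖g‖)
    (hD₁M : ∀ t g, ‖D₁ t g‖ ≤ M * ‖g‖) (hA₂M : ∀ t g, ‖A₂ t g‖ ≤ M * ‖g‖)
    (hB₂M : ∀ t g, ‖B₂ t g‖ ≤ M * ‖g‖) (hD₂M : ∀ t g, ‖D₂ t g‖ ≤ M * ‖g‖)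
    (f₁ f₂ : Lp L2Ω 2 (expMeasure γ T)) (v₁ v₂ : V) :
    ∃ z ∈ solutionSpace hT hγ π, ∃ y ∈ solutionSpace hT hγ π, ∃ x₁ x₂ : Lp V 2 (expMeasure γ T),
      ∃ r₁ r₂ : Lp L2Ω 2 (expMeasure γ T), z.1 = v₁ ∧ y.1 = v₂ ∧
      x₁ = (adjoint π).compLpL 2 (expMeasure γ T) z.2.2 ∧
      x₂ = (adjoint π).compLpL 2 (expMeasure γ T) y.2.2 ∧
      (r₁ =ᵐ[expMeasure γ T] fun t => A₁ t (Λ (x₁ t)) + B₁ t (π (x₁ t)) + D₁ t (π (x₂ t))) ∧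
      (r₂ =ᵐ[expMeasure γ T] fun t => A₂ t (Λ (x₂ t)) + B₂ t (π (x₂ t)) + D₂ t (π (x₁ t))) ∧
      (parabolicOp π β z).1 + r₁ = f₁ ∧ (parabolicOp π β y).1 + r₂ = f₂ ∧
      ‖parabolicOp π β z‖ ≤ 2 * (‖f₁‖ + ‖f₂‖ + ‖v₁‖ + ‖v₂‖) ∧
      ‖parabolicOp π β y‖ ≤ 2 * (‖f₁‖ + ‖f₂‖ + ‖v₁‖ + ‖v₂‖) := by
  obtain ⟨R, hRn, hR⟩ := exists_lowerOrderOp hM hΛ hπ hA₁ hB₁ hD₁ hA₁M hB₁M hD₁M (expMeasure γ T)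
  obtain ⟨S, hSn, hS⟩ := exists_lowerOrderOp hM hΛ hπ hA₂ hB₂ hD₂ hA₂M hB₂M hD₂M (expMeasure γ T)
  -- in the second equation the roles of the two unknowns are exchanged
  obtain ⟨S', hS'⟩ := exists_comp_swap S
  obtain ⟨z, hz, y, hy, hz0, hy0, hzf, hyf, hzn, hyn⟩ := exists_system_solution hT hγ hb₀ hM hβ
    hπ hinj hD (m := 2 * M + 1) (by linarith) hMγ R S' hRn (fun p => by
      rw [hS', add_comm ‖p.1‖]
      exact hSn (p.2, p.1)) f₁ f₂ v₁ v₂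
  rw [hS'] at hyf
  generalize hx₁ : (adjoint π).compLpL 2 (expMeasure γ T) z.2.2 = x₁ at hzf hyf
  generalize hx₂ : (adjoint π).compLpL 2 (expMeasure γ T) y.2.2 = x₂ at hzf hyf
  exact ⟨z, hz, y, hy, x₁, x₂, R (x₁, x₂), S (x₂, x₁), hz0, hy0, hx₁.symm, hx₂.symm,
    hR (x₁, x₂), hS (x₂, x₁), hzf, hyf, hzn, hyn⟩

/-- The identity `u' + b A u + R(u,v) = f` in `L²(0,T;L²(0,1))`, read off at almost every time. -/
lemma equation_solutionFun {a b : ℝ → ℝ} {ha : WeaklyDegenerate a} {hT : 0 ≤ T} {hγ : 0 ≤ γ}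
    {b₀ M : ℝ} {β : Lp L2Ω 2 (expMeasure γ T) →L[ℝ] Lp L2Ω 2 (expMeasure γ T)}
    (hβ : IsMul b₀ M b β)
    {z y : formSpace ha × Lp L2Ω 2 (expMeasure γ T) × Lp L2Ω 2 (expMeasure γ T)}
    (hz : z ∈ solutionSpace hT hγ ha.embedding) (hy : y ∈ solutionSpace hT hγ ha.embedding)
    {A B D : ℝ → L2Ω →L[ℝ] L2Ω} {x₁ x₂ : Lp (formSpace ha) 2 (expMeasure γ T)}
    (hx₁ : x₁ = (adjoint ha.embedding).compLpL 2 (expMeasure γ T) z.2.2)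
    (hx₂ : x₂ = (adjoint ha.embedding).compLpL 2 (expMeasure γ T) y.2.2)
    {r f : Lp L2Ω 2 (expMeasure γ T)}
    (hr : r =ᵐ[expMeasure γ T] fun t => A t (ha.weightedDeriv (x₁ t)) + B t (ha.embedding (x₁ t)) +
        D t (ha.embedding (x₂ t)))
    (hf : (parabolicOp ha.embedding β z).1 + r = f) :
    ∀ᵐ t ∂(μT T), timeDeriv T (solutionFun ha z) t - b t • divADx a (solutionFun ha z t)
      + (A t (sqrtADx a (solutionFun ha z t)) + B t (solutionFun ha z t)
        + D t (solutionFun ha y t)) = f t := by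
  have hac := absolutelyContinuous_expMeasure hγ T
  set Jw := (resolvent ha.embedding).compLpL 2 (expMeasure γ T) z.2.2 with hJw
  rw [parabolicOp_apply, ← hJw] at hf
  filter_upwards [(hasTimeDeriv_solutionFun hγ z).timeDeriv_ae_eq hT, divADx_solutionFun hz,
    sqrtADx_solutionFun hz, solutionFun_ae_eq hz, solutionFun_ae_eq hy, hac.ae_le hr,
    hac.ae_le (Lp.coeFn_add (z.2.1 + β (z.2.2 - Jw)) r),
    hac.ae_le (Lp.coeFn_add z.2.1 (β (z.2.2 - Jw))), hac.ae_le (hβ.coeFn (z.2.2 - Jw)),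
    hac.ae_le (Lp.coeFn_sub z.2.2 Jw),
    hac.ae_le ((resolvent ha.embedding).coeFn_compLpL (p := 2) z.2.2),
    hac.ae_le ((adjoint ha.embedding).coeFn_compLpL (p := 2) z.2.2),
    hac.ae_le ((adjoint ha.embedding).coeFn_compLpL (p := 2) y.2.2)]
    with t e1 e2 e3 e4 e5 e6 e7 e8 e9 e10 e11 e12 e13
  rw [← hf, e7, Pi.add_apply, e8, Pi.add_apply, e9, e10, Pi.sub_apply, e6, e1, e2, e3, e4, e5,
    hJw, e11, hx₁, hx₂, e12, e13, ← neg_sub (z.2.2 t), smul_neg, sub_neg_eq_add]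
  rfl

end Existence

end

end DegenerateSystem


open DegenerateSystem in
theorem proposition2p1 (T b₀ M : ℝ) (hT : 0 < T) (hb₀ : 0 < b₀) :
    ∃ C : ℝ, 0 < C ∧
      ∀ (c : DegenerateSystem.Coefficients), c.Admissible T b₀ M →
      ∀ (α β : ℝ), 0 ≤ α → α < β → β ≤ 1 →
      ∀ (u₀ v₀ : DegenerateSystem.L2Ω),
        DegenerateSystem.MemH1a c.a u₀ → DegenerateSystem.MemH1a c.a v₀ →
      ∀ (h : Lp (Lp ℝ 2 (volume.restrict (Ioo α β))) 2 (DegenerateSystem.μT T))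
        (H₁ H₂ : Lp DegenerateSystem.L2Ω 2 (DegenerateSystem.μT T)),
      ∃ u v : ℝ → DegenerateSystem.L2Ω,
        DegenerateSystem.IsSolution T c α β u₀ v₀ h H₁ H₂ u v ∧
        (∀ u' v' : ℝ → DegenerateSystem.L2Ω,
          DegenerateSystem.IsSolution T c α β u₀ v₀ h H₁ H₂ u' v' →
            EqOn u' u (Icc 0 T) ∧ EqOn v' v (Icc 0 T)) ∧
        DegenerateSystem.normE T c.a u + DegenerateSystem.normE T c.a v ≤
          C * (DegenerateSystem.normH1a c.a u₀ + DegenerateSystem.normH1a c.a v₀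
            + ‖h‖ + (‖H₁‖ + ‖H₂‖)) := by
  -- `M ≥ 0` is known only once an admissible coefficient is given, hence the absolute values; the
  -- lower-order terms have norm at most `m`, and `γ` is the threshold in `exists_weak_solution`
  set m := 2 * |M| + 1 with hm
  set γ := |M| + (1 / 2 + 1 / (2 * b₀)) * (4 * m) ^ 2 with hγdef
  have hγ : 0 ≤ γ := by positivity
  set K := (1 + 2 * |M| * (1 + 1 / b₀)) + (1 + 1 / b₀) with hK
  -- each unknown contributes `8 e^{γT} K` (`normE_solutionFun_le`) times twice the data
  refine ⟨32 * Real.exp (γ * T) * K, by positivity, ?_⟩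
  intro c hc α β hα _ hβ u₀ v₀ hu₀ hv₀ h H₁ H₂
  have hM := hc.nonneg hT hb₀
  rw [abs_of_nonneg hM] at hm hK hγdef
  have hMγ : M ≤ γ := by
    have : 0 ≤ (1 / 2 + 1 / (2 * b₀)) * (4 * m) ^ 2 := by positivity
    linarith
  have ha := hc.a_deg
  obtain ⟨A₁, hA₁m, hA₁, hA₁c⟩ := exists_mulOp hM hc.d₁_bdd
  obtain ⟨A₂, hA₂m, hA₂, hA₂c⟩ := exists_mulOp hM hc.d₂_bdd
  obtain ⟨B₁₁, hB₁₁m, hB₁₁, hB₁₁c⟩ := exists_mulOp hM hc.b₁₁_bdd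
  obtain ⟨B₁₂, hB₁₂m, hB₁₂, hB₁₂c⟩ := exists_mulOp hM hc.b₁₂_bdd
  obtain ⟨B₂₁, hB₂₁m, hB₂₁, hB₂₁c⟩ := exists_mulOp hM hc.b₂₁_bdd
  obtain ⟨B₂₂, hB₂₂m, hB₂₂, hB₂₂c⟩ := exists_mulOp hM hc.b₂₂_bdd
  obtain ⟨L, hL, hLn⟩ := exists_extendZero hα hβ
  obtain ⟨b, hb⟩ := exists_isMul hM hb₀ hc.b_mem.1.aestronglyMeasurable hc.b_lower hc.b_upper γ
  set f₁ : Lp L2Ω 2 (μT T) := L.compLpL 2 (μT T) h + H₁ with hf₁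
  have hf₁n : ‖f₁‖ ≤ ‖h‖ + ‖H₁‖ := by
    refine (norm_add_le _ _).trans (add_le_add_left ?_ _)
    exact ((L.norm_compLp_le h).trans (mul_le_mul_of_nonneg_right hLn (norm_nonneg h))).trans_eq
      (one_mul _)
  obtain ⟨z, hz, y, hy, x₁, x₂, r₁, r₂, hz0, hy0, hx₁, hx₂, hr₁, hr₂, hzf, hyf, hzn, hyn⟩ :=
    exists_weak_solution hT.le hγ hb₀ hM hb ha.norm_weightedDeriv_le ha.norm_embedding_le
      ha.embedding_injective ha.adjoint_embedding_injective (hm ▸ hγdef.ge)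
      hA₁m hB₁₁m hB₁₂m hA₂m hB₂₂m hB₂₁m hA₁ hB₁₁ hB₁₂ hA₂ hB₂₂ hB₂₁
      ((memLp_expMeasure hγ (Lp.memLp f₁)).toLp f₁) ((memLp_expMeasure hγ (Lp.memLp H₂)).toLp H₂)
      (ha.toForm hu₀.hasSqrtADx) (ha.toForm hv₀.hasSqrtADx)
  have hac := absolutelyContinuous_expMeasure hγ T
  have eqz := equation_solutionFun hb hz hy hx₁ hx₂ hr₁ hzf
  have eqy := equation_solutionFun hb hy hz hx₂ hx₁ hr₂ hyf
  have hsol : IsSolution T c α β u₀ v₀ h H₁ H₂ (solutionFun ha z) (solutionFun ha y) := by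
    refine ⟨memL2H2a_solutionFun hz, memL2H2a_solutionFun hy,
      ⟨_, hasTimeDeriv_solutionFun hγ z⟩, ⟨_, hasTimeDeriv_solutionFun hγ y⟩, ?_, ?_, ?_, ?_⟩
    · rw [solutionFun_zero, hz0, ha.embedding_toForm]
    · rw [solutionFun_zero, hy0, ha.embedding_toForm]
    · filter_upwards [eqz, hac.ae_le (memLp_expMeasure hγ (Lp.memLp f₁)).coeFn_toLp,
        Lp.coeFn_add (L.compLpL 2 (μT T) h) H₁, L.coeFn_compLpL (p := 2) h, hA₁c, hB₁₁c, hB₁₂c]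
        with t e1 e2 e3 e4 e5 e6 e7
      have hr : (L (h t) + H₁ t : L2Ω) =ᵐ[μΩ] fun x => (Ioo α β).indicator (h t) x + H₁ t x := by
        filter_upwards [Lp.coeFn_add (L (h t)) (H₁ t), hL (h t)] with x e1 e2
        rw [e1, Pi.add_apply, e2]
      refine (equation_iff e5 e6 e7 hr).2 (e1.trans ?_)
      rw [e2, hf₁, e3, Pi.add_apply, e4]
    · filter_upwards [eqy, hac.ae_le (memLp_expMeasure hγ (Lp.memLp H₂)).coeFn_toLp,
        hA₂c, hB₂₁c, hB₂₂c] with t e1 e2 e3 e4 e5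
      refine (equation_iff e3 e4 e5 (Filter.EventuallyEq.refl _ (H₂ t))).2 ?_
      rw [← e2, ← e1]
      abel
  refine ⟨solutionFun ha z, solutionFun ha y, hsol,
    fun u' v' hs => hs.eqOn hT hb₀ hc hα hβ hsol, ?_⟩
  set N := normH1a c.a u₀ + normH1a c.a v₀ + ‖h‖ + (‖H₁‖ + ‖H₂‖) with hN
  have hdata : ‖(memLp_expMeasure hγ (Lp.memLp f₁)).toLp f₁‖ +
      ‖(memLp_expMeasure hγ (Lp.memLp H₂)).toLp H₂‖ + ‖ha.toForm hu₀.hasSqrtADx‖ +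
      ‖ha.toForm hv₀.hasSqrtADx‖ ≤ N := by
    rw [ha.norm_toForm hu₀, ha.norm_toForm hv₀, hN]
    have := norm_toLp_expMeasure_le hγ f₁
    have := norm_toLp_expMeasure_le hγ H₂
    linarith
  have bound : ∀ z ∈ solutionSpace hT.le hγ ha.embedding,
      ‖parabolicOp ha.embedding b z‖ ≤ 2 * N →
      normE T c.a (solutionFun ha z) ≤ 8 * Real.exp (γ * T) * (K * (2 * N)) := by
    intro z hz hzN
    have h1 := norm_timeDeriv_le hT.le hγ hb₀ hM hMγ hb ha.norm_embedding_le hz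
    have h2 := norm_multiplier_le hT.le hγ hb₀ hMγ hb hz
    have h3 : 0 ≤ (1 + 2 * M * (1 + 1 / b₀)) * ‖parabolicOp ha.embedding b z‖ := by positivity
    have h4 : 0 ≤ (1 + 1 / b₀) * ‖parabolicOp ha.embedding b z‖ := by positivity
    have h5 : K * ‖parabolicOp ha.embedding b z‖ ≤ K * (2 * N) :=
      mul_le_mul_of_nonneg_left hzN (by rw [hK]; positivity)
    rw [hK, add_mul] at h5
    rw [hK]
    exact normE_solutionFun_le hz (by linarith) (by linarith)
  have hz' := bound z hz (hzn.trans (by linarith))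
  have hy' := bound y hy (hyn.trans (by linarith))
  calc _ ≤ 8 * Real.exp (γ * T) * (K * (2 * N)) + 8 * Real.exp (γ * T) * (K * (2 * N)) :=
        add_le_add hz' hy'
    _ = 32 * Real.exp (γ * T) * K * N := by ring
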